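/- Let $n\ge 1$ and let $M^{2n+1}(\varphi,\zeta,\eta,g)$ be a Kenmotsu manifold, that is, a smooth (Hausdorff) manifold of dimension $2n+1$ with a smooth Riemannian metric $g$, a smooth $(1,1)$-tensor field $\varphi$, a smooth unit vector field $\zeta$ and the $1$-form $\eta=g(\cdot,\zeta)$ such that, for all vector fields $X,Y$, $$\varphi^2X=-X+\eta(X)\zeta,\qquad g(\varphi X,\varphi Y)=g(X,Y)-\eta(X)\eta(Y),\qquad (\nabla_X\varphi)Y=g(\varphi X,Y)\zeta-\eta(Y)\varphi X,$$ where $\nabla$ is the Levi-Civita connection of $g$. Let $R(X,Y)=\nabla_X\nabla_Y-\nabla_Y\nabla_X-\nabla_{[X,Y]}$ be the curvature tensor, $S(Y,Z)=\mathrm{tr}\,(X\mapsto R(X,Y)Z)$ the Ricci tensor, $Q$ the Ricci operator, $g(QX,Y)=S(X,Y)$, and $r=\mathrm{tr}\,Q$ the scalar curvature. Let $\alpha,\beta\in\mathbb R$ with $\alpha\ne0$, and suppose that $g$ is a gradient almost Ricci–Yamabe soliton of type $(\alpha,\beta)$: there are smooth functions $f,\lambda$ on $M$ with $$\nabla^2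 f+\alpha S=\Bigl(\lambda-\tfrac12\beta r\Bigr)g .$$ Then: 1. $M$ is $\eta$-Einstein, i.e. $S=a\,g+b\,\eta\otimes\eta$ for some smooth functions $a,b$ on $M$; more precisely, for every tangent vector $X$, $$QX=\Bigl(\frac{r}{2n}+1\Bigr)X-\Bigl(\frac{r}{2n}+2n+1\Bigr)\eta(X)\,\zeta .$$ 2. If moreover $\zeta r=0$ on $M$, then locally $$\lambda=A\cosh t+B\sinh t-2n\alpha-n\beta(2n+1),$$ where $t$ is the parameter along $\zeta$ and $A,B$ do not depend on $t$. Precisely: every point of $M$ has an open neighbourhood $U$ with smooth functions $t,A,B$ on $U$ such that $dt=\eta$, $\zeta A=\zeta B=0$ and the formula for $\lambda$ holds on $U$; and for every integral curve $\gamma:(a,b)\to M$ of $\zeta$ there are real constants $A,B$ such that $\lambda(\gamma(t))=A\cosh t+B\sinh t-2n\alpha-n\beta(2n+1)$ for all $t\in(a,b)$. -/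

import Mathlib

open Bundle Manifold Set
open scoped ContDiff Topology

noncomputable section

namespace Kenmotsu

section General

variable {E : Type*} [NormedAddCommGroup E] [NormedSpace ℝ E]
  {H : Type*} [TopologicalSpace H] (I : ModelWithCorners ℝ E H)
  {M : Type*} [TopologicalSpace M] [ChartedSpace H M] [IsManifold I ∞ M]
  [RiemannianBundle (fun x : M ↦ TangentSpace I x)]

/-- The Koszul expression: one half of
`X g(Y,Z) + Y g(Z,X) - Z g(X,Y) + g([X,Y],Z) - g([Y,Z],X) + g([Z,X],Y)` at `x`. -/
def koszul (X Y Z : Π x : M, TangentSpace I x) (x : M) : ℝ :=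
  (1 / 2 : ℝ) *
    (mvfderiv I (fun y ↦ inner ℝ (Y y) (Z y)) x (X x)
      + mvfderiv I (fun y ↦ inner ℝ (Z y) (X y)) x (Y x)
      - mvfderiv I (fun y ↦ inner ℝ (X y) (Y y)) x (Z x)
      + inner ℝ (VectorField.mlieBracket I X Y x) (Z x)
      - inner ℝ (VectorField.mlieBracket I Y Z x) (X x)
      + inner ℝ (VectorField.mlieBracket I Z X x) (Y x))

variable [FiniteDimensional ℝ E]
  [IsContMDiffRiemannianBundle I ∞ E (fun x : M ↦ TangentSpace I x)]

instance (x : M) : FiniteDimensional ℝ (TangentSpace I x) :=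
  inferInstanceAs (FiniteDimensional ℝ E)

instance (x : M) : CompleteSpace (TangentSpace I x) := FiniteDimensional.complete ℝ _

section Leibniz

variable {f : M → ℝ} {X X' Y Z : Π x : M, TangentSpace I x} {x : M}

theorem mdifferentiableAt_inner (hX : MDiffAt (T% X) x) (hY : MDiffAt (T% Y) x) :
    MDiffAt (fun y ↦ inner ℝ (X y) (Y y)) x := by
  apply MDifferentiableAt.inner_bundle (F := E) (E := fun x : M ↦ TangentSpace I x) (IB := I)
  exacts [hX, hY]

theorem mvfderiv_inner_smul_left (hf : MDiffAt f x) (hX : MDiffAt (T% X) x)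
    (hY : MDiffAt (T% Y) x) :
    mvfderiv I (fun y ↦ inner ℝ ((f • X) y) (Y y)) x
      = f x • mvfderiv I (fun y ↦ inner ℝ (X y) (Y y)) x + inner ℝ (X x) (Y x) • mvfderiv I f x := by
  have : (fun y ↦ inner ℝ ((f • X) y) (Y y)) = f * fun y ↦ inner ℝ (X y) (Y y) := by
    ext y; simp [inner_smul_left]
  rw [this, mvfderiv_mul hf (mdifferentiableAt_inner I hX hY)]

theorem mvfderiv_inner_smul_right (hf : MDiffAt f x) (hX : MDiffAt (T% X) x)
    (hY : MDiffAt (T% Y) x) :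
    mvfderiv I (fun y ↦ inner ℝ (Y y) ((f • X) y)) x
      = f x • mvfderiv I (fun y ↦ inner ℝ (Y y) (X y)) x + inner ℝ (Y x) (X x) • mvfderiv I f x := by
  simp_rw [fun y ↦ real_inner_comm ((f • X) y) (Y y), fun y ↦ real_inner_comm (X y) (Y y)]
  exact mvfderiv_inner_smul_left I hf hX hY

theorem mvfderiv_inner_add_left (hX : MDiffAt (T% X) x) (hX' : MDiffAt (T% X') x)
    (hY : MDiffAt (T% Y) x) :
    mvfderiv I (fun y ↦ inner ℝ ((X + X') y) (Y y)) x
      = mvfderiv I (fun y ↦ inner ℝ (X y) (Y y)) x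
        + mvfderiv I (fun y ↦ inner ℝ (X' y) (Y y)) x := by
  have : (fun y ↦ inner ℝ ((X + X') y) (Y y))
      = (fun y ↦ inner ℝ (X y) (Y y)) + fun y ↦ inner ℝ (X' y) (Y y) := by
    ext y; simp [inner_add_left]
  rw [this, mvfderiv_add (mdifferentiableAt_inner I hX hY) (mdifferentiableAt_inner I hX' hY)]

theorem mvfderiv_inner_add_right (hX : MDiffAt (T% X) x) (hX' : MDiffAt (T% X') x)
    (hY : MDiffAt (T% Y) x) :
    mvfderiv I (fun y ↦ inner ℝ (Y y) ((X + X') y)) x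
      = mvfderiv I (fun y ↦ inner ℝ (Y y) (X y)) x
        + mvfderiv I (fun y ↦ inner ℝ (Y y) (X' y)) x := by
  simp_rw [fun y ↦ real_inner_comm ((X + X') y) (Y y), fun y ↦ real_inner_comm (X y) (Y y),
    fun y ↦ real_inner_comm (X' y) (Y y)]
  exact mvfderiv_inner_add_left I hX hX' hY

theorem koszul_tensorial_left (hY : MDiffAt (T% Y) x) (hZ : MDiffAt (T% Z) x) :
    TensorialAt I E (fun X ↦ koszul I X Y Z x) x where
  smul {f X} hf hX := by
    have : CompleteSpace E := FiniteDimensional.complete ℝ E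
    simp only [koszul, VectorField.mlieBracket_smul_left hf hX,
      VectorField.mlieBracket_smul_right hf hX, mvfderiv_inner_smul_left I hf hX hY,
      mvfderiv_inner_smul_right I hf hX hZ]
    simp [inner_smul_left, inner_smul_right, inner_add_left, inner_neg_left,
      real_inner_comm (X x)]
    ring
  add {X X'} hX hX' := by
    have : CompleteSpace E := FiniteDimensional.complete ℝ E
    simp only [koszul, VectorField.mlieBracket_add_left hX hX',
      VectorField.mlieBracket_add_right hX hX', mvfderiv_inner_add_left I hX hX' hY,
      mvfderiv_inner_add_right I hX hX' hZ]
    simp [inner_add_left, inner_add_right]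
    ring

theorem koszul_tensorial_right (hX : MDiffAt (T% X) x) (hY : MDiffAt (T% Y) x) :
    TensorialAt I E (fun Z ↦ koszul I X Y Z x) x where
  smul {f Z} hf hZ := by
    have : CompleteSpace E := FiniteDimensional.complete ℝ E
    simp only [koszul, VectorField.mlieBracket_smul_left hf hZ,
      VectorField.mlieBracket_smul_right hf hZ, mvfderiv_inner_smul_left I hf hZ hX,
      mvfderiv_inner_smul_right I hf hZ hY]
    simp [inner_smul_left, inner_smul_right, inner_add_left, inner_neg_left]
    rw [real_inner_comm (Y x) (Z x)]
    ring
  add {Z Z'} hZ hZ' := by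
    have : CompleteSpace E := FiniteDimensional.complete ℝ E
    simp only [koszul, VectorField.mlieBracket_add_left hZ hZ',
      VectorField.mlieBracket_add_right hZ hZ', mvfderiv_inner_add_left I hZ hZ' hX,
      mvfderiv_inner_add_right I hZ hZ' hY]
    simp [inner_add_left, inner_add_right]
    ring

theorem koszul_add_mid {Y' : Π x : M, TangentSpace I x} (hX : MDiffAt (T% X) x)
    (hY : MDiffAt (T% Y) x) (hY' : MDiffAt (T% Y') x) (hZ : MDiffAt (T% Z) x) :
    koszul I X (Y + Y') Z x = koszul I X Y Z x + koszul I X Y' Z x := by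
  have : CompleteSpace E := FiniteDimensional.complete ℝ E
  simp only [koszul, VectorField.mlieBracket_add_left hY hY',
    VectorField.mlieBracket_add_right hY hY', mvfderiv_inner_add_left I hY hY' hZ,
    mvfderiv_inner_add_right I hY hY' hX]
  simp [inner_add_left, inner_add_right]
  ring

theorem koszul_smul_mid (hf : MDiffAt f x) (hX : MDiffAt (T% X) x)
    (hY : MDiffAt (T% Y) x) (hZ : MDiffAt (T% Z) x) :
    koszul I X (f • Y) Z x
      = f x * koszul I X Y Z x + mvfderiv I f x (X x) * inner ℝ (Y x) (Z x) := by
  have : CompleteSpace E := FiniteDimensional.complete ℝ E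
  simp only [koszul, VectorField.mlieBracket_smul_left hf hY,
    VectorField.mlieBracket_smul_right hf hY, mvfderiv_inner_smul_left I hf hY hZ,
    mvfderiv_inner_smul_right I hf hY hX]
  simp [inner_smul_left, inner_smul_right, inner_add_left, inner_neg_left]
  rw [real_inner_comm (X x) (Y x)]
  ring

end Leibniz

open Classical in
/-- The value at `x` of `v ↦ ∇_v Y`: the endomorphism of `T_x M` with
`g(∇_v Y, w) = koszul X Y Z x` for vector fields `X`, `Z` with `X x = v` and `Z x = w`
(and `0` if `Y` is not differentiable at `x`). -/
def leviCivitaAt (Y : Π x : M, TangentSpace I x) (x : M) :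
    TangentSpace I x →L[ℝ] TangentSpace I x :=
  if hY : MDiffAt (T% Y) x then
    InnerProductSpace.continuousLinearMapOfBilin (𝕜 := ℝ)
      (TensorialAt.mkHom₂ (I := I) (F := E) (F' := E) (fun X Z ↦ koszul I X Y Z x) x
        (fun _ hZ ↦ koszul_tensorial_left I hY hZ) (fun _ hX ↦ koszul_tensorial_right I hX hY))
  else 0

theorem inner_leviCivitaAt {X Y Z : Π x : M, TangentSpace I x} {x : M} (hX : MDiffAt (T% X) x)
    (hY : MDiffAt (T% Y) x) (hZ : MDiffAt (T% Z) x) :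
    inner ℝ (leviCivitaAt I Y x (X x)) (Z x) = koszul I X Y Z x := by
  rw [leviCivitaAt, dif_pos hY]
  refine (InnerProductSpace.continuousLinearMapOfBilin_apply _ _ _).trans ?_
  exact TensorialAt.mkHom₂_apply (fun _ hZ ↦ koszul_tensorial_left I hY hZ)
    (fun _ hX ↦ koszul_tensorial_right I hX hY) hX hZ

theorem inner_leviCivitaAt_extend {Y : Π x : M, TangentSpace I x} {x : M}
    (hY : MDiffAt (T% Y) x) (v w : TangentSpace I x) :
    inner ℝ (leviCivitaAt I Y x v) w
      = koszul I (FiberBundle.extend E v) Y (FiberBundle.extend E w) x := by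
  rw [← inner_leviCivitaAt I (FiberBundle.mdifferentiableAt_extend ..) hY
    (FiberBundle.mdifferentiableAt_extend ..)]
  simp

/-- The Levi-Civita connection of the Riemannian metric, through the Koszul formula. As everywhere
in Mathlib, `leviCivita I Y x v` is `(∇_v Y)(x)`, for `Y` differentiable at `x`. -/
def leviCivita : CovariantDerivative I E (fun x : M ↦ TangentSpace I x) where
  toFun := leviCivitaAt I
  isCovariantDerivativeOnUniv :=
    { add := by
        intro Y Y' x hY hY' _
        ext v
        refine ext_inner_right ℝ fun w ↦ ?_
        rw [_root_.add_apply, inner_add_left,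
          inner_leviCivitaAt_extend I (mdifferentiableAt_add_section hY hY'),
          inner_leviCivitaAt_extend I hY, inner_leviCivitaAt_extend I hY']
        exact koszul_add_mid I (FiberBundle.mdifferentiableAt_extend ..) hY hY'
          (FiberBundle.mdifferentiableAt_extend ..)
      leibniz := by
        intro Y f x hY hf _
        ext v
        refine ext_inner_right ℝ fun w ↦ ?_
        rw [_root_.add_apply, inner_add_left, _root_.smul_apply, real_inner_smul_left,
          inner_leviCivitaAt_extend I (hf.smul_section hY), inner_leviCivitaAt_extend I hY,
          koszul_smul_mid I hf (FiberBundle.mdifferentiableAt_extend ..) hY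
            (FiberBundle.mdifferentiableAt_extend ..)]
        simp [inner_smul_left] }

theorem inner_leviCivita {X Y Z : Π x : M, TangentSpace I x} {x : M} (hX : MDiffAt (T% X) x)
    (hY : MDiffAt (T% Y) x) (hZ : MDiffAt (T% Z) x) :
    inner ℝ (leviCivita I Y x (X x)) (Z x) = koszul I X Y Z x :=
  inner_leviCivitaAt I hX hY hZ

/-- The Levi-Civita connection is torsion-free. -/
theorem leviCivita_torsion {X Y : Π x : M, TangentSpace I x} {x : M} (hX : MDiffAt (T% X) x)
    (hY : MDiffAt (T% Y) x) :
    leviCivita I Y x (X x) - leviCivita I X x (Y x) = VectorField.mlieBracket I X Y x := by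
  refine ext_inner_right ℝ fun w ↦ ?_
  have hw := FiberBundle.mdifferentiableAt_extend I E w
  have h1 := inner_leviCivita I hX hY hw
  have h2 := inner_leviCivita I hY hX hw
  simp only [koszul, FiberBundle.extend_apply_self] at h1 h2
  rw [inner_sub_left, h1, h2, VectorField.mlieBracket_swap_apply (V := Y) (W := X),
    VectorField.mlieBracket_swap_apply (V := Y) (W := FiberBundle.extend E w),
    VectorField.mlieBracket_swap_apply (V := FiberBundle.extend E w) (W := X)]
  simp only [inner_neg_left, fun y ↦ real_inner_comm (X y) (Y y),
    fun y ↦ real_inner_comm (X y) (FiberBundle.extend E w y),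
    fun y ↦ real_inner_comm (FiberBundle.extend E w y) (Y y)]
  ring

/-- The Levi-Civita connection is metric. -/
theorem leviCivita_metric {X Y Z : Π x : M, TangentSpace I x} {x : M} (hX : MDiffAt (T% X) x)
    (hY : MDiffAt (T% Y) x) (hZ : MDiffAt (T% Z) x) :
    mvfderiv I (fun y ↦ inner ℝ (Y y) (Z y)) x (X x)
      = inner ℝ (leviCivita I Y x (X x)) (Z x) + inner ℝ (Y x) (leviCivita I Z x (X x)) := by
  have h1 := inner_leviCivita I hX hY hZ
  have h2 := inner_leviCivita I hX hZ hY
  rw [real_inner_comm] at h2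
  rw [h1, h2, koszul, koszul, VectorField.mlieBracket_swap_apply (V := Y) (W := X),
    VectorField.mlieBracket_swap_apply (V := Y) (W := Z),
    VectorField.mlieBracket_swap_apply (V := Z) (W := X)]
  simp only [inner_neg_left, fun y ↦ real_inner_comm (X y) (Y y),
    fun y ↦ real_inner_comm (X y) (Z y), fun y ↦ real_inner_comm (Z y) (Y y)]
  ring

/-- The curvature `R(u,v)w = ∇_U ∇_V W - ∇_V ∇_U W - ∇_[U,V] W` at `x`, where `U`, `V`, `W` are
smooth local extensions of `u`, `v`, `w`. -/
def curvature (x : M) (u v w : TangentSpace I x) : TangentSpace I x :=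
  let U : Π y : M, TangentSpace I y := FiberBundle.extend E u
  let V : Π y : M, TangentSpace I y := FiberBundle.extend E v
  let W : Π y : M, TangentSpace I y := FiberBundle.extend E w
  leviCivita I (fun y ↦ leviCivita I W y (V y)) x u
    - leviCivita I (fun y ↦ leviCivita I W y (U y)) x v
    - leviCivita I W x (VectorField.mlieBracket I U V x)

/-- The Ricci tensor `S(v,w)`, the trace of `u ↦ R(u,v)w`, computed in an orthonormal basis. -/
def ricci (x : M) (v w : TangentSpace I x) : ℝ :=
  ∑ i, inner ℝ (curvature I x (stdOrthonormalBasis ℝ (TangentSpace I x) i) v w)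
    (stdOrthonormalBasis ℝ (TangentSpace I x) i)

/-- The Ricci operator `Q`, determined by `g(Q v, w) = S(v,w)`. -/
def ricciOp (x : M) (v : TangentSpace I x) : TangentSpace I x :=
  ∑ i, ricci I x v (stdOrthonormalBasis ℝ (TangentSpace I x) i) •
    stdOrthonormalBasis ℝ (TangentSpace I x) i

/-- The scalar curvature `r`, the trace of the Ricci tensor. -/
def scalarCurvature (x : M) : ℝ :=
  ∑ i, ricci I x (stdOrthonormalBasis ℝ (TangentSpace I x) i)
    (stdOrthonormalBasis ℝ (TangentSpace I x) i)

/-- The gradient of a function. -/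
def grad (f : M → ℝ) (x : M) : TangentSpace I x :=
  (InnerProductSpace.toDual ℝ (TangentSpace I x)).symm (mvfderiv I f x)

/-- The Hessian `∇²f (v,w) = g(∇_v grad f, w)`. -/
def hessian (f : M → ℝ) (x : M) (v w : TangentSpace I x) : ℝ :=
  inner ℝ (leviCivita I (grad I f) x v) w

/-- `(φ, ζ, η)` is an almost contact metric structure for the given Riemannian metric. -/
structure IsAlmostContactMetric (φ : Π x : M, TangentSpace I x →L[ℝ] TangentSpace I x)
    (ζ : Π x : M, TangentSpace I x) (η : Π x : M, TangentSpace I x →L[ℝ] ℝ) : Prop where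
  smooth_phi : ContMDiff I (I.prod 𝓘(ℝ, E →L[ℝ] E)) ∞
    (fun x ↦ TotalSpace.mk' (E →L[ℝ] E)
      (E := fun x : M ↦ TangentSpace I x →L[ℝ] TangentSpace I x) x (φ x))
  smooth_zeta : ContMDiff I (I.prod 𝓘(ℝ, E)) ∞
    (fun x ↦ TotalSpace.mk' E (E := fun x : M ↦ TangentSpace I x) x (ζ x))
  smooth_eta : ContMDiff I (I.prod 𝓘(ℝ, E →L[ℝ] ℝ)) ∞
    (fun x ↦ TotalSpace.mk' (E →L[ℝ] ℝ)
      (E := fun x : M ↦ TangentSpace I x →L[ℝ] Bundle.Trivial M ℝ x) x (η x))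
  inner_zeta_self : ∀ x, inner ℝ (ζ x) (ζ x) = 1
  phi_phi : ∀ x v, φ x (φ x v) = -v + η x v • ζ x
  eta_apply : ∀ x v, η x v = inner ℝ v (ζ x)
  inner_phi_phi : ∀ x v w, inner ℝ (φ x v) (φ x w) = inner ℝ v w - η x v * η x w

/-- `(φ, ζ, η)` is a Kenmotsu structure for the given Riemannian metric: an almost contact metric
structure with `(∇_X φ) Y = g(φ X, Y) ζ - η(Y) φ X`, where `(∇_X φ) Y = ∇_X (φ Y) - φ (∇_X Y)`. -/
structure IsKenmotsu (φ : Π x : M, TangentSpace I x →L[ℝ] TangentSpace I x)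
    (ζ : Π x : M, TangentSpace I x) (η : Π x : M, TangentSpace I x →L[ℝ] ℝ) : Prop extends
    IsAlmostContactMetric I φ ζ η where
  nabla_phi : ∀ (x : M) (v : TangentSpace I x) (Y : Π y : M, TangentSpace I y),
    MDiffAt (T% Y) x →
      leviCivita I (fun y ↦ φ y (Y y)) x v - φ x (leviCivita I Y x v)
        = inner ℝ (φ x v) (Y x) • ζ x - η x (Y x) • φ x v

/-- The metric, with potential function `f` and soliton function `lam`, is a gradient almost
Ricci-Yamabe soliton of type `(α, β)`: `∇²f + α S = (lam - β r / 2) g`. -/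
structure IsGradientAlmostRicciYamabeSoliton (α β : ℝ) (f lam : M → ℝ) : Prop where
  smooth_potential : ContMDiff I 𝓘(ℝ) ∞ f
  smooth_lam : ContMDiff I 𝓘(ℝ) ∞ lam
  soliton_eq : ∀ (x : M) (v w : TangentSpace I x),
    hessian I f x v w + α * ricci I x v w
      = (lam x - 1 / 2 * β * scalarCurvature I x) * inner ℝ v w

/-- The metric is `η`-Einstein: `S = a g + b η ⊗ η` for smooth functions `a`, `b`. -/
def IsEtaEinstein (η : Π x : M, TangentSpace I x →L[ℝ] ℝ) : Prop :=
  ∃ a b : M → ℝ, ContMDiff I 𝓘(ℝ) ∞ a ∧ ContMDiff I 𝓘(ℝ) ∞ b ∧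
    ∀ (x : M) (v w : TangentSpace I x),
      ricci I x v w = a x * inner ℝ v w + b x * (η x v * η x w)

end General

end Kenmotsu

end

/-!
The almost contact structure enters only through its characteristic field: the Kenmotsu equation
gives `∇_v ζ = v - η(v) ζ` (`IsKenmotsu.isKenmotsuField`), and the structure `IsKenmotsuField`
keeps just this and `g(ζ,ζ) = 1`. Write `m = 2n + 1` for the dimension. Differentiating once more,
`R(X,Y)ζ = η(X)Y - η(Y)X`, hence `S(·,ζ) = -2n η`. Feeding this into the second Bianchi identity for
`ζ, X, Y` gives `(∇_ζ R)(X,Y)W = -2 R(X,Y)W + 2 (g(X,W)Y - g(Y,W)X)`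
(`IsKenmotsuField.der_zeta_riem`), whose traces are `∇_ζ S = -2 S - 4n g` and
`ζ r = -2 (r + 2n(2n+1))`.

Let `μ = λ - β r / 2`, so that `∇²f = μ g - α S`. The number `g(R(ζ,Y)∇f, W)` is known from the
formula for `R(X,Y)ζ`, and it is also the commutator of the second covariant derivatives of `∇f`,
in which `∇_ζ S` is known and `(∇_Y S)(ζ,·)` is computed from `S(ζ,·) = -2n η`. Comparing the two
expressions (`IsKenmotsuField.ricci_of_hessian`),
`α S(v,w) = (ζf - ζμ - 2nα) g(v,w) + (dμ - df)(v) η(w)`. Taking `w = ζ` shows that `dμ - df` is a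
multiple of `η`, and the trace finds this multiple in terms of `r`. This is the `η`-Einstein
formula, valid because `α ≠ 0`.

If `ζ r = 0`, the equation for `ζ r` forces `r = -2n(2n+1)`. Then `S = -2n g` and `dμ(ζ) = df(ζ)`,
and `u = μ + 2nα = λ + 2nα + nβ(2n+1)` satisfies `∇²f = u g`. The integral curves of `ζ` being
geodesics, `ζ ζ f = u`, and therefore `ζ ζ u = u`. Along an integral curve this is `u'' = u`.
Locally on `M`, the form `η` is closed because `∇η` is symmetric, so `η = dt` by the Poincaré lemma
in a ball of a chart (`IsKenmotsuField.exists_potential`), and `A = u cosh t - (ζu) sinh t`,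
`B = (ζu) cosh t - u sinh t` are constant along `ζ` with `u = A cosh t + B sinh t`.

Vector fields are smooth on open sets rather than globally, and the curvature of such fields
(`curv`) is shown to be tensorial, so that it computes the curvature tensor at each point
(`curvature_eq`). Smoothness of covariant derivatives comes from the Koszul formula together with
local orthonormal frames. Both the smoothness of `X f` and the formula for `[X,Y] f` are read off
from brackets with `f Z`, where `Z` is a unit field.
-/

open Bundle Manifold Set
open scoped ContDiff Topology

noncomputable section

set_option linter.unusedSectionVars false

namespace Kenmotsu

section Calculus

variable {E : Type*} [NormedAddCommGroup E] [NormedSpace ℝ E] [FiniteDimensional ℝ E]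
  {H : Type*} [TopologicalSpace H] {I : ModelWithCorners ℝ E H}
  {M : Type*} [TopologicalSpace M] [ChartedSpace H M] [IsManifold I ∞ M]

/-! ### Smooth vector fields, Lie brackets and the Levi-Civita connection -/

/-- Smoothness of a vector field on a set. -/
abbrev SmoothField (U : Set M) (X : Π x : M, TangentSpace I x) : Prop :=
  ContMDiffOn I (I.prod 𝓘(ℝ, E)) ∞ (T% X) U

variable (I) in
/-- Smoothness of a real function on a set. -/
abbrev SmoothFun (U : Set M) (f : M → ℝ) : Prop :=
  ContMDiffOn I 𝓘(ℝ) ∞ f U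

/-- The derivative `X f` of a function along a vector field. -/
def der (X : Π x : M, TangentSpace I x) (f : M → ℝ) : M → ℝ :=
  fun y ↦ mvfderiv I f y (X y)

/-- The Lie bracket of two vector fields. -/
def br (X Y : Π x : M, TangentSpace I x) : Π x : M, TangentSpace I x :=
  VectorField.mlieBracket I X Y

variable {U : Set M} {X Y Z W : Π x : M, TangentSpace I x} {f g : M → ℝ} {x : M}

theorem SmoothField.contMDiffAt (hX : SmoothField U X) (hU : IsOpen U) (hx : x ∈ U) :
    ContMDiffAt I (I.prod 𝓘(ℝ, E)) ∞ (T% X) x :=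
  ContMDiffOn.contMDiffAt hX (hU.mem_nhds hx)

theorem SmoothField.mdifferentiableAt (hX : SmoothField U X) (hU : IsOpen U) (hx : x ∈ U) :
    MDiffAt (T% X) x :=
  (hX.contMDiffAt hU hx).mdifferentiableAt (by simp)

theorem SmoothFun.mdifferentiableAt (hf : SmoothFun I U f) (hU : IsOpen U) (hx : x ∈ U) :
    MDiffAt f x :=
  (ContMDiffOn.contMDiffAt hf (hU.mem_nhds hx)).mdifferentiableAt (by simp)

theorem SmoothField.add (hX : SmoothField U X) (hY : SmoothField U Y) : SmoothField U (X + Y) :=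
  ContMDiffOn.add_section hX hY

theorem SmoothField.sub (hX : SmoothField U X) (hY : SmoothField U Y) : SmoothField U (X - Y) :=
  ContMDiffOn.sub_section hX hY

theorem SmoothField.smul (hf : SmoothFun I U f) (hX : SmoothField U X) : SmoothField U (f • X) :=
  ContMDiffOn.smul_section hf hX

theorem SmoothField.congr (hX : SmoothField U X) (h : ∀ y ∈ U, Y y = X y) : SmoothField U Y :=
  ContMDiffOn.congr hX fun y hy ↦ by simp [h y hy]

theorem SmoothField.smooth_br (hU : IsOpen U) (hX : SmoothField U X) (hY : SmoothField U Y) :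
    SmoothField U (br X Y) := by
  have : CompleteSpace E := FiniteDimensional.complete ℝ E
  have : IsManifold I (minSmoothness ℝ 2) M := by
    simp only [minSmoothness_of_isRCLikeNormedField]; infer_instance
  have : IsManifold I (((⊤ : ℕ∞) : WithTop ℕ∞) + 1) M := inferInstanceAs (IsManifold I ∞ M)
  exact fun y hy ↦ (ContMDiffAt.mlieBracket_vectorField (m := ⊤) (n := ⊤) (hX.contMDiffAt hU hy)
    (hY.contMDiffAt hU hy) (by simp)).contMDiffWithinAt

theorem der_congr (hU : IsOpen U) (h : ∀ y ∈ U, f y = g y) (hx : x ∈ U) :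
    der X f x = der X g x := by
  have : f =ᶠ[𝓝 x] g := Filter.eventuallyEq_of_mem (hU.mem_nhds hx) h
  simp only [der, mvfderiv, this.mfderiv_eq]
  rfl

theorem br_congr {X' Y' : Π x : M, TangentSpace I x} (hU : IsOpen U) (hX : ∀ y ∈ U, X y = X' y)
    (hY : ∀ y ∈ U, Y y = Y' y) (hx : x ∈ U) : br X Y x = br X' Y' x :=
  Filter.EventuallyEq.mlieBracket_vectorField_eq
    (Filter.eventuallyEq_of_mem (hU.mem_nhds hx) hX)
    (Filter.eventuallyEq_of_mem (hU.mem_nhds hx) hY)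

theorem br_smul_right (hU : IsOpen U) (hf : SmoothFun I U f) (hY : SmoothField U Y) (hx : x ∈ U) :
    br X (f • Y) x = der X f x • Y x + f x • br X Y x :=
  have : CompleteSpace E := FiniteDimensional.complete ℝ E
  VectorField.mlieBracket_smul_right (hf.mdifferentiableAt hU hx) (hY.mdifferentiableAt hU hx)

theorem br_smul_left (hU : IsOpen U) (hf : SmoothFun I U f) (hX : SmoothField U X) (hx : x ∈ U) :
    br (f • X) Y x = - der Y f x • X x + f x • br X Y x :=
  have : CompleteSpace E := FiniteDimensional.complete ℝ E
  VectorField.mlieBracket_smul_left (hf.mdifferentiableAt hU hx) (hX.mdifferentiableAt hU hx)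

theorem br_add_left (hU : IsOpen U) (hX : SmoothField U X) (hY : SmoothField U Y) (hx : x ∈ U) :
    br (X + Y) Z x = br X Z x + br Y Z x :=
  have : CompleteSpace E := FiniteDimensional.complete ℝ E
  VectorField.mlieBracket_add_left (hX.mdifferentiableAt hU hx) (hY.mdifferentiableAt hU hx)

theorem br_add_right (hU : IsOpen U) (hX : SmoothField U X) (hY : SmoothField U Y) (hx : x ∈ U) :
    br Z (X + Y) x = br Z X x + br Z Y x :=
  have : CompleteSpace E := FiniteDimensional.complete ℝ E
  VectorField.mlieBracket_add_right (hX.mdifferentiableAt hU hx) (hY.mdifferentiableAt hU hx)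

theorem br_swap : br X Y x = - br Y X x :=
  VectorField.mlieBracket_swap_apply

theorem br_jacobi (hU : IsOpen U) (hX : SmoothField U X) (hY : SmoothField U Y)
    (hZ : SmoothField U Z) (hx : x ∈ U) :
    br X (br Y Z) x = br (br X Y) Z x + br Y (br X Z) x := by
  have : CompleteSpace E := FiniteDimensional.complete ℝ E
  have : IsManifold I (minSmoothness ℝ 3) M := by
    simp only [minSmoothness_of_isRCLikeNormedField]; infer_instance
  have h2 : minSmoothness ℝ 2 ≤ ∞ := by
    simp only [minSmoothness_of_isRCLikeNormedField]
    exact WithTop.coe_le_coe.2 le_top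
  exact VectorField.leibniz_identity_mlieBracket_apply
    ((hX.contMDiffAt hU hx).of_le h2) ((hY.contMDiffAt hU hx).of_le h2)
    ((hZ.contMDiffAt hU hx).of_le h2)

variable [RiemannianBundle (fun x : M ↦ TangentSpace I x)]
  [IsContMDiffRiemannianBundle I ∞ E (fun x : M ↦ TangentSpace I x)]

/-- The function `g(X, Y)`. -/
def ip (X Y : Π x : M, TangentSpace I x) : M → ℝ := fun y ↦ inner ℝ (X y) (Y y)

theorem SmoothField.smooth_ip (hX : SmoothField U X) (hY : SmoothField U Y) :
    SmoothFun I U (ip X Y) := by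
  apply ContMDiffOn.inner_bundle (F := E) (E := fun x : M ↦ TangentSpace I x) (IB := I)
  exacts [hX, hY]

/-- `∇_X Y` for the Levi-Civita connection. -/
def nabla (X Y : Π x : M, TangentSpace I x) : Π x : M, TangentSpace I x :=
  fun y ↦ leviCivita I Y y (X y)

theorem nabla_torsion (hU : IsOpen U) (hX : SmoothField U X) (hY : SmoothField U Y) (hx : x ∈ U) :
    nabla X Y x - nabla Y X x = br X Y x :=
  leviCivita_torsion I (hX.mdifferentiableAt hU hx) (hY.mdifferentiableAt hU hx)

theorem der_ip (hU : IsOpen U) (hX : SmoothField U X) (hY : SmoothField U Y)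
    (hZ : SmoothField U Z) (hx : x ∈ U) :
    der X (ip Y Z) x = ip (nabla X Y) Z x + ip Y (nabla X Z) x :=
  leviCivita_metric I (hX.mdifferentiableAt hU hx) (hY.mdifferentiableAt hU hx)
    (hZ.mdifferentiableAt hU hx)

theorem nabla_add (hU : IsOpen U) (hY : SmoothField U Y) (hZ : SmoothField U Z) (hx : x ∈ U) :
    nabla X (Y + Z) x = nabla X Y x + nabla X Z x := by
  have := (leviCivita I (M := M)).isCovariantDerivativeOnUniv.add
    (hY.mdifferentiableAt hU hx) (hZ.mdifferentiableAt hU hx)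
  exact congr($this (X x))

theorem nabla_smul (hU : IsOpen U) (hf : SmoothFun I U f) (hY : SmoothField U Y) (hx : x ∈ U) :
    nabla X (f • Y) x = f x • nabla X Y x + der X f x • Y x := by
  have := (leviCivita I (M := M)).isCovariantDerivativeOnUniv.leibniz
    (hY.mdifferentiableAt hU hx) (hf.mdifferentiableAt hU hx)
  exact congr($this (X x))

theorem nabla_sub (hU : IsOpen U) (hY : SmoothField U Y) (hZ : SmoothField U Z) (hx : x ∈ U) :
    nabla X (Y - Z) x = nabla X Y x - nabla X Z x := by
  rw [eq_sub_iff_add_eq, ← nabla_add hU (hY.sub hZ) hZ hx, sub_add_cancel]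

theorem nabla_congr (hU : IsOpen U) (hY : SmoothField U Y) (h : ∀ y ∈ U, Z y = Y y) (hx : x ∈ U) :
    nabla X Z x = nabla X Y x := by
  have := (leviCivita I (M := M)).isCovariantDerivativeOnUniv.congr_of_eventuallyEq
    ((hY.congr h).mdifferentiableAt hU hx) (hY.mdifferentiableAt hU hx) Filter.univ_mem
    (Filter.eventually_of_mem (hU.mem_nhds hx) h)
  exact congr($this (X x))

theorem nabla_add_left : nabla (X + Y) Z x = nabla X Z x + nabla Y Z x := by
  simp [nabla]

theorem nabla_sub_left : nabla (X - Y) Z x = nabla X Z x - nabla Y Z x := by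
  simp [nabla]

theorem nabla_smul_left : nabla (f • X) Z x = f x • nabla X Z x := by
  simp [nabla]

/-! ### Orthonormal frames -/

/-- The frame `e` is orthonormal and smooth on `U`. -/
structure IsOrthonormalFrame {ι : Type*} (U : Set M) (e : ι → Π x : M, TangentSpace I x) :
    Prop where
  smooth : ∀ i, SmoothField U (e i)
  orthonormal : ∀ y ∈ U, Orthonormal ℝ (fun i ↦ e i y)
  span : ∀ y ∈ U, ⊤ ≤ Submodule.span ℝ (range fun i ↦ e i y)

/-- Smooth orthonormal frames exist locally: apply the Gram–Schmidt process to the frame of a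
trivialization. -/
theorem exists_isOrthonormalFrame (x : M) : ∃ (U : Set M)
    (e : Fin (Module.finrank ℝ E) → Π x : M, TangentSpace I x),
    IsOpen U ∧ x ∈ U ∧ IsOrthonormalFrame U e := by
  let t := trivializationAt E (fun x : M ↦ TangentSpace I x) x
  let b := Module.finBasis ℝ E
  let s : Fin (Module.finrank ℝ E) → Π x : M, TangentSpace I x := t.localFrame b
  have hs : IsLocalFrameOn I E ∞ s t.baseSet := t.isLocalFrameOn_localFrame_baseSet I ∞ b
  refine ⟨t.baseSet, fun i y ↦ InnerProductSpace.gramSchmidtNormed ℝ (fun j ↦ s j y) i,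
    t.open_baseSet, FiberBundle.mem_baseSet_trivializationAt' x, ⟨?_, ?_, ?_⟩⟩
  · have hG : ∀ i, SmoothField t.baseSet
        (fun y ↦ InnerProductSpace.gramSchmidt ℝ (fun j ↦ s j y) i) := by
      intro i
      induction i using WellFoundedLT.induction with
      | ind i ih =>
        have h1 : (fun y ↦ InnerProductSpace.gramSchmidt ℝ (fun j ↦ s j y) i)
          = s i - fun y ↦ ∑ j ∈ Finset.Iio i,
            ((inner ℝ (InnerProductSpace.gramSchmidt ℝ (fun j ↦ s j y) j) (s i y) /
              inner ℝ (InnerProductSpace.gramSchmidt ℝ (fun j ↦ s j y) j)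
                (InnerProductSpace.gramSchmidt ℝ (fun j ↦ s j y) j) : ℝ) •
              InnerProductSpace.gramSchmidt ℝ (fun j ↦ s j y) j) := by
          ext y
          rw [InnerProductSpace.gramSchmidt_def]
          simp [Submodule.starProjection_singleton]
        rw [h1]
        refine SmoothField.sub (hs.contMDiffOn i) ?_
        refine ContMDiffOn.sum_section fun j hj ↦ ?_
        have hj' := ih j (Finset.mem_Iio.1 hj)
        refine ContMDiffOn.smul_section ?_ hj'
        refine ContMDiffOn.div₀ (hj'.smooth_ip (hs.contMDiffOn i)) (hj'.smooth_ip hj') fun y hy ↦ ?_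
        exact inner_self_ne_zero.2
          (InnerProductSpace.gramSchmidt_ne_zero _ (hs.linearIndependent hy))
    intro i
    refine ContMDiffOn.smul_section ?_ (hG i)
    refine ContMDiffOn.inv₀ ?_ fun y hy ↦ ?_
    · have : ContMDiffOn I 𝓘(ℝ) ∞ (fun y ↦ Real.sqrt
        (inner ℝ (InnerProductSpace.gramSchmidt ℝ (fun j ↦ s j y) i)
          (InnerProductSpace.gramSchmidt ℝ (fun j ↦ s j y) i))) t.baseSet := by
        intro y hy
        refine ContMDiffAt.comp_contMDiffWithinAt (I' := 𝓘(ℝ)) y (g := Real.sqrt) ?_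
          ((hG i).smooth_ip (hG i) y hy)
        rw [contMDiffAt_iff_contDiffAt]
        exact Real.contDiffAt_sqrt (inner_self_ne_zero.2
          (InnerProductSpace.gramSchmidt_ne_zero _ (hs.linearIndependent hy)))
      refine this.congr fun y hy ↦ ?_
      rw [norm_eq_sqrt_real_inner]
      rfl
    · simpa using InnerProductSpace.gramSchmidt_ne_zero _ (hs.linearIndependent hy)
  · intro y hy
    exact InnerProductSpace.gramSchmidtNormed_orthonormal (hs.linearIndependent hy)
  · intro y hy
    rw [InnerProductSpace.span_gramSchmidtNormed_range, InnerProductSpace.span_gramSchmidt]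
    exact hs.generating hy

section

theorem SmoothField.mono {V : Set M} (hX : SmoothField U X) (h : V ⊆ U) : SmoothField V X :=
  ContMDiffOn.mono hX h

theorem ip_comm (X Y : Π x : M, TangentSpace I x) : ip X Y = ip Y X :=
  funext fun _ ↦ real_inner_comm _ _

namespace IsOrthonormalFrame

variable {ι : Type*} {e : ι → Π x : M, TangentSpace I x}

theorem mono {V : Set M} (he : IsOrthonormalFrame U e) (h : V ⊆ U) : IsOrthonormalFrame V e where
  smooth i := (he.smooth i).mono h
  orthonormal y hy := he.orthonormal y (h hy)
  span y hy := he.span y (h hy)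

/-- The orthonormal basis of a tangent space given by an orthonormal frame. -/
def basis [Fintype ι] (he : IsOrthonormalFrame U e) (hx : x ∈ U) :
    OrthonormalBasis ι ℝ (TangentSpace I x) :=
  OrthonormalBasis.mk (he.orthonormal x hx) (he.span x hx)

@[simp]
theorem basis_apply [Fintype ι] (he : IsOrthonormalFrame U e) (hx : x ∈ U) (i : ι) :
    he.basis hx i = e i x := by
  simp [basis]

theorem sum_inner_smul [Fintype ι] (he : IsOrthonormalFrame U e) (hx : x ∈ U)
    (v : TangentSpace I x) : ∑ i, inner ℝ (e i x) v • e i x = v := by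
  simpa using (he.basis hx).sum_repr' v

end IsOrthonormalFrame

/-- Smoothness can be tested against smooth fields: a field whose inner products with
all smooth local fields are smooth is smooth. -/
theorem SmoothField.of_ip (hU : IsOpen U)
    (h : ∀ (V : Set M) (Z : Π x : M, TangentSpace I x), IsOpen V → V ⊆ U → SmoothField V Z →
      SmoothFun I V (ip Z X)) : SmoothField U X := by
  intro x hx
  obtain ⟨V, e, hV, hxV, he⟩ := exists_isOrthonormalFrame (I := I) x
  have hUV := hU.inter hV
  replace he := he.mono (inter_subset_right (s := U))
  have h1 : SmoothField (U ∩ V) fun y ↦ ∑ i, inner ℝ (e i y) (X y) • e i y :=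
    ContMDiffOn.sum_section fun i _ ↦ ContMDiffOn.smul_section
      (h (U ∩ V) (e i) hUV inter_subset_left (he.smooth i)) (he.smooth i)
  exact ((h1.congr fun y hy ↦ (he.sum_inner_smul hy (X y)).symm).contMDiffAt hUV
    ⟨hx, hxV⟩).contMDiffWithinAt

/-! ### Smoothness of derivatives and of covariant derivatives -/

variable [Nontrivial E]

theorem exists_unit_field (x : M) : ∃ (U : Set M) (Z : Π x : M, TangentSpace I x),
    IsOpen U ∧ x ∈ U ∧ SmoothField U Z ∧ ∀ y ∈ U, ip Z Z y = 1 := by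
  obtain ⟨U, e, hU, hx, he⟩ := exists_isOrthonormalFrame (I := I) x
  refine ⟨U, e ⟨0, Module.finrank_pos⟩, hU, hx, he.smooth _, fun y hy ↦ ?_⟩
  simp [ip, (he.orthonormal y hy).1]

/-- The derivative `X f` of a smooth function along a smooth field is smooth: it is the
coefficient `g([X, f Z] - f [X, Z], Z)` for a unit field `Z`. -/
theorem SmoothField.smooth_der (hU : IsOpen U) (hX : SmoothField U X) (hf : SmoothFun I U f) :
    SmoothFun I U (der X f) := by
  intro x hx
  obtain ⟨V, Z, hV, hxV, hZ, hZ1⟩ := exists_unit_field (I := I) x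
  have hUV := hU.inter hV
  have hX' := hX.mono (inter_subset_left (t := V))
  have hf' : SmoothFun I (U ∩ V) f := ContMDiffOn.mono hf inter_subset_left
  have hZ' := hZ.mono (inter_subset_right (s := U))
  have h1 : SmoothFun I (U ∩ V) (ip (br X (f • Z) - f • br X Z) Z) :=
    ((hX'.smooth_br hUV (hZ'.smul hf')).sub ((hX'.smooth_br hUV hZ').smul hf')).smooth_ip hZ'
  refine ContMDiffAt.contMDiffWithinAt (ContMDiffOn.contMDiffAt (h1.congr fun y hy ↦ ?_)
    (hUV.mem_nhds ⟨hx, hxV⟩))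
  have := hZ1 y hy.2
  simp only [Kenmotsu.ip, Pi.sub_apply, br_smul_right hUV hf' hZ' hy] at this ⊢
  rw [show (f • br X Z) y = f y • br X Z y from rfl, add_sub_cancel_right, inner_smul_left,
    this]
  simp

/-- `[X, Y] f = X (Y f) - Y (X f)`, from the Jacobi identity for `X`, `Y` and `f Z` where `Z` is a
unit field. -/
theorem der_br (hU : IsOpen U) (hX : SmoothField U X) (hY : SmoothField U Y)
    (hf : SmoothFun I U f) (hx : x ∈ U) :
    der (br X Y) f x = der X (der Y f) x - der Y (der X f) x := by
  obtain ⟨V, Z, hV, hxV, hZ, hZ1⟩ := exists_unit_field (I := I) x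
  have hUV := hU.inter hV
  replace hX := hX.mono (inter_subset_left (t := V))
  replace hY := hY.mono (inter_subset_left (t := V))
  replace hf : SmoothFun I (U ∩ V) f := ContMDiffOn.mono hf inter_subset_left
  replace hZ := hZ.mono (inter_subset_right (s := U))
  have hx' : x ∈ U ∩ V := ⟨hx, hxV⟩
  have key : ∀ A B : Π x : M, TangentSpace I x, SmoothField (U ∩ V) A → SmoothField (U ∩ V) B →
      br A (br B (f • Z)) x = der A (der B f) x • Z x + der B f x • br A Z x
        + der A f x • br B Z x + f x • br A (br B Z) x := by
    intro A B hA hB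
    have h1 : br A (br B (f • Z)) x = br A (der B f • Z + f • br B Z) x :=
      br_congr hUV (fun _ _ ↦ rfl) (fun y hy ↦ by
        simp [br_smul_right hUV hf hZ hy]) hx'
    rw [h1, br_add_right hUV (hZ.smul (hB.smooth_der hUV hf)) ((hB.smooth_br hUV hZ).smul hf) hx',
      br_smul_right hUV (hB.smooth_der hUV hf) hZ hx',
      br_smul_right hUV hf (hB.smooth_br hUV hZ)
        hx']
    abel
  have h := br_jacobi hUV hX hY (hZ.smul hf) hx'
  rw [key X Y hX hY, key Y X hY hX, br_smul_right hUV hf hZ hx', br_jacobi hUV hX hY hZ hx'] at h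
  have h2 := congr(inner ℝ $h (Z x))
  have h3 : inner ℝ (Z x) (Z x) = (1 : ℝ) := hZ1 x hxV
  simp only [inner_add_left, inner_smul_left, smul_add, h3] at h2
  simp at h2
  linarith

/-- The Koszul formula. -/
theorem ip_nabla (hU : IsOpen U) (hX : SmoothField U X) (hY : SmoothField U Y)
    (hZ : SmoothField U Z) (hx : x ∈ U) :
    ip (nabla X Y) Z x = 1 / 2 * (der X (ip Y Z) x + der Y (ip Z X) x - der Z (ip X Y) x
      + ip (br X Y) Z x - ip (br Y Z) X x + ip (br Z X) Y x) :=
  inner_leviCivita I (hX.mdifferentiableAt hU hx) (hY.mdifferentiableAt hU hx)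
    (hZ.mdifferentiableAt hU hx)

theorem SmoothFun.add (hf : SmoothFun I U f) (hg : SmoothFun I U g) :
    SmoothFun I U fun y ↦ f y + g y := ContMDiffOn.add hf hg

theorem SmoothFun.sub (hf : SmoothFun I U f) (hg : SmoothFun I U g) :
    SmoothFun I U fun y ↦ f y - g y := ContMDiffOn.sub hf hg

theorem SmoothFun.const_mul (c : ℝ) (hf : SmoothFun I U f) :
    SmoothFun I U fun y ↦ c * f y := ContMDiffOn.mul contMDiffOn_const hf

theorem SmoothField.smooth_nabla (hU : IsOpen U) (hX : SmoothField U X) (hY : SmoothField U Y) :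
    SmoothField U (nabla X Y) := by
  refine SmoothField.of_ip hU fun V Z hV hVU hZ ↦ ?_
  replace hX := hX.mono hVU
  replace hY := hY.mono hVU
  have h : SmoothFun I V fun y ↦ (1 / 2 : ℝ) * (der X (ip Y Z) y
      + der Y (ip Z X) y - der Z (ip X Y) y
      + ip (br X Y) Z y - ip (br Y Z) X y
      + ip (br Z X) Y y) :=
    SmoothFun.const_mul _ ((((((hX.smooth_der hV (hY.smooth_ip hZ)).add
      (hY.smooth_der hV (hZ.smooth_ip hX))).sub (hZ.smooth_der hV (hX.smooth_ip hY))).add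
      ((hX.smooth_br hV hY).smooth_ip hZ)).sub ((hY.smooth_br hV hZ).smooth_ip hX)).add
      ((hZ.smooth_br hV hX).smooth_ip hY))
  exact h.congr fun y hy ↦ by rw [ip_comm, ip_nabla hV hX hY hZ hy]

end

/-! ### The curvature of vector fields and its symmetries -/

/-- The curvature `∇_X ∇_Y Z - ∇_Y ∇_X Z - ∇_[X,Y] Z` of vector fields. -/
def curv (X Y Z : Π x : M, TangentSpace I x) : Π x : M, TangentSpace I x :=
  nabla X (nabla Y Z) - nabla Y (nabla X Z) - nabla (br X Y) Z

theorem curv_apply (X Y Z : Π x : M, TangentSpace I x) (x : M) :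
    curv X Y Z x = nabla X (nabla Y Z) x - nabla Y (nabla X Z) x - nabla (br X Y) Z x := rfl

theorem nabla_neg_left : nabla (-X) Z x = - nabla X Z x := by
  simp [nabla]

theorem nabla_congr_left {X' : Π x : M, TangentSpace I x} (h : X x = X' x) :
    nabla X Z x = nabla X' Z x := by
  simp [nabla, h]

theorem curv_swap : curv X Y Z x = - curv Y X Z x := by
  have h : nabla (br X Y) Z x = - nabla (br Y X) Z x := by
    rw [← nabla_neg_left]; exact nabla_congr_left br_swap
  rw [curv_apply, curv_apply, h]
  abel

theorem br_jacobi_cyclic (hU : IsOpen U) (hX : SmoothField U X) (hY : SmoothField U Y)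
    (hZ : SmoothField U Z) (hx : x ∈ U) :
    br X (br Y Z) x + br Y (br Z X) x + br Z (br X Y) x = 0 := by
  have : CompleteSpace E := FiniteDimensional.complete ℝ E
  have h4 := br_jacobi hU hX hY hZ hx
  have h5 : br (br X Y) Z x = - br Z (br X Y) x := br_swap
  have h6 : br Y (br X Z) x = - br Y (br Z X) x := by
    have e : br X Z = (-1 : ℝ) • br Z X := by
      rw [neg_one_smul]; exact VectorField.mlieBracket_swap
    rw [e, ← neg_one_smul ℝ (br Y (br Z X) x)]
    exact VectorField.mlieBracket_const_smul_right
      ((hZ.smooth_br hU hX).mdifferentiableAt hU hx)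
  rw [h4, h5, h6]
  abel

section

variable [Nontrivial E]

theorem smooth_curv (hU : IsOpen U) (hX : SmoothField U X) (hY : SmoothField U Y)
    (hZ : SmoothField U Z) : SmoothField U (curv X Y Z) :=
  ((hX.smooth_nabla hU (hY.smooth_nabla hU hZ)).sub
    (hY.smooth_nabla hU (hX.smooth_nabla hU hZ))).sub ((hX.smooth_br hU hY).smooth_nabla hU hZ)

/-- First Bianchi identity. -/
theorem curv_bianchi (hU : IsOpen U) (hX : SmoothField U X) (hY : SmoothField U Y)
    (hZ : SmoothField U Z) (hx : x ∈ U) :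
    curv X Y Z x + curv Y Z X x + curv Z X Y x = 0 := by
  have key : ∀ A B C : Π x : M, TangentSpace I x, SmoothField U A → SmoothField U B →
      SmoothField U C →
      nabla A (nabla B C) x - nabla A (nabla C B) x = nabla (br B C) A x + br A (br B C) x := by
    intro A B C hA hB hC
    have e : nabla A (nabla B C - nabla C B) x = nabla A (br B C) x :=
      nabla_congr hU (hB.smooth_br hU hC) (fun y hy ↦ nabla_torsion hU hB hC hy) hx
    rw [← nabla_sub hU (hB.smooth_nabla hU hC) (hC.smooth_nabla hU hB) hx, e,
      ← nabla_torsion hU hA (hB.smooth_br hU hC) hx]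
    abel
  have h1 := key X Y Z hX hY hZ
  have h2 := key Y Z X hY hZ hX
  have h3 := key Z X Y hZ hX hY
  have h4 := br_jacobi_cyclic hU hX hY hZ hx
  simp only [curv_apply]
  calc _ = (nabla X (nabla Y Z) x - nabla X (nabla Z Y) x)
      + (nabla Y (nabla Z X) x - nabla Y (nabla X Z) x)
      + (nabla Z (nabla X Y) x - nabla Z (nabla Y X) x)
      - nabla (br X Y) Z x - nabla (br Y Z) X x - nabla (br Z X) Y x := by abel
    _ = br X (br Y Z) x + br Y (br Z X) x + br Z (br X Y) x := by
      rw [h1, h2, h3]; abel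
    _ = 0 := h4

theorem ip_curv_skew (hU : IsOpen U) (hX : SmoothField U X) (hY : SmoothField U Y)
    (hZ : SmoothField U Z) (hW : SmoothField U W) (hx : x ∈ U) :
    ip (curv X Y Z) W x = - ip (curv X Y W) Z x := by
  have key : ∀ A B : Π x : M, TangentSpace I x, SmoothField U A → SmoothField U B →
      der A (der B (ip Z W)) x = ip (nabla A (nabla B Z)) W x + ip (nabla B Z) (nabla A W) x
        + (ip (nabla A Z) (nabla B W) x + ip Z (nabla A (nabla B W)) x) := by
    intro A B hA hB
    have hBZ := hB.smooth_nabla hU hZ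
    have hBW := hB.smooth_nabla hU hW
    rw [der_congr hU (g := ip (nabla B Z) W + ip Z (nabla B W))
      (fun y hy ↦ der_ip hU hB hZ hW hy) hx]
    rw [← der_ip hU hA hBZ hW hx, ← der_ip hU hA hZ hBW hx]
    simp only [der]
    rw [mvfderiv_add ((hBZ.smooth_ip hW).mdifferentiableAt hU hx)
      ((hZ.smooth_ip hBW).mdifferentiableAt hU hx)]
    rfl
  have h1 := key X Y hX hY
  have h2 := key Y X hY hX
  have h3 := der_ip hU (hX.smooth_br hU hY) hZ hW hx
  have h4 := der_br hU hX hY (hZ.smooth_ip hW) hx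
  simp only [ip, curv_apply, inner_sub_left] at *
  rw [real_inner_comm (Z x) (nabla X (nabla Y W) x), real_inner_comm (Z x) (nabla Y (nabla X W) x),
    real_inner_comm (Z x) (nabla (br X Y) W x)] at *
  linarith

/-- Pair symmetry of the curvature, from the first Bianchi identity and the two skew symmetries. -/
theorem ip_curv_pair (hU : IsOpen U) (hX : SmoothField U X) (hY : SmoothField U Y)
    (hZ : SmoothField U Z) (hW : SmoothField U W) (hx : x ∈ U) :
    ip (curv X Y Z) W x = ip (curv Z W X) Y x := by
  have key : ∀ A B C D : Π x : M, TangentSpace I x, SmoothField U A → SmoothField U B →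
      SmoothField U C → SmoothField U D →
      ip (curv A B C) D x + ip (curv B C A) D x + ip (curv C A B) D x = 0 := by
    intro A B C D hA hB hC hD
    have := congr(inner ℝ $(curv_bianchi hU hA hB hC hx) (D x))
    simpa [ip, inner_add_left] using this
  have sw : ∀ A B C D : Π x : M, TangentSpace I x, ip (curv A B C) D x = - ip (curv B A C) D x := by
    intro A B C D
    simp only [ip]
    rw [curv_swap, inner_neg_left]
  have b1 := key X Y Z W hX hY hZ hW
  have b2 := key Y Z W X hY hZ hW hX
  have b3 := key Z W X Y hZ hW hX hY
  have b4 := key W X Y Z hW hX hY hZ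
  have s1 := ip_curv_skew hU hX hY hZ hW hx
  have s2 := ip_curv_skew hU hY hZ hX hW hx
  have s3 := ip_curv_skew hU hZ hX hY hW hx
  have s4 := ip_curv_skew hU hZ hW hX hY hx
  have s5 := ip_curv_skew hU hW hX hY hZ hx
  have s6 := ip_curv_skew hU hW hY hX hZ hx
  have t1 := sw W Y Z X
  have t2 := sw X Z W Y
  have t3 := sw Y W X Z
  have t4 := sw X Z Y W
  linarith

/-! ### Tensoriality of the curvature -/

/-- A functional on smooth fields over an open set that is linear over the smooth functions, in the
sense that functions are evaluated at `x`, depends on the value of the field at `x` only. -/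
theorem eq_of_tensorial (hU : IsOpen U) (hx : x ∈ U) {F : Type*} [AddCommGroup F] [Module ℝ F]
    (Φ : (Π x : M, TangentSpace I x) → F)
    (hadd : ∀ (V : Set M) (X Y : Π x : M, TangentSpace I x), IsOpen V → V ⊆ U → x ∈ V →
      SmoothField V X → SmoothField V Y → Φ (X + Y) = Φ X + Φ Y)
    (hsmul : ∀ (V : Set M) (f : M → ℝ) (X : Π x : M, TangentSpace I x), IsOpen V → V ⊆ U → x ∈ V →
      SmoothFun I V f → SmoothField V X → Φ (f • X) = f x • Φ X)
    (hcongr : ∀ (V : Set M) (X Y : Π x : M, TangentSpace I x), IsOpen V → V ⊆ U → x ∈ V →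
      SmoothField V X → (∀ y ∈ V, Y y = X y) → Φ Y = Φ X)
    (hX : SmoothField U X) (hY : SmoothField U Y) (hXY : X x = Y x) : Φ X = Φ Y := by
  -- expand the fields in an orthonormal frame
  obtain ⟨V, e, hV, hxV, he⟩ := exists_isOrthonormalFrame (I := I) x
  have hUV := hU.inter hV
  have hsub : U ∩ V ⊆ U := inter_subset_left
  have hx' : x ∈ U ∩ V := ⟨hx, hxV⟩
  replace he := he.mono (inter_subset_right (s := U))
  have key : ∀ Z : Π x : M, TangentSpace I x, SmoothField U Z →
      Φ Z = ∑ i, inner ℝ (e i x) (Z x) • Φ (e i) := by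
    intro Z hZ
    have hsm : ∀ i, SmoothFun I (U ∩ V) (ip (e i) Z) := fun i ↦
      (he.smooth i).smooth_ip (hZ.mono hsub)
    have h0 : Φ 0 = 0 := by
      have := hsmul (U ∩ V) (fun _ ↦ 0) Z hUV hsub hx' contMDiffOn_const (hZ.mono hsub)
      rw [zero_smul] at this
      rw [← this]
      congr 1
      ext y
      simp
    have hs : ∀ s : Finset (Fin (Module.finrank ℝ E)),
        SmoothField (U ∩ V) (∑ i ∈ s, ip (e i) Z • e i) ∧
        Φ (∑ i ∈ s, ip (e i) Z • e i) = ∑ i ∈ s, inner ℝ (e i x) (Z x) • Φ (e i) := by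
      intro s
      induction s using Finset.cons_induction with
      | empty =>
        refine ⟨?_, by simpa using h0⟩
        exact (SmoothField.smul (f := fun _ ↦ 0) contMDiffOn_const (hZ.mono hsub)).congr
          fun y _ ↦ by simp
      | cons a s ha ih =>
        have hsa := (he.smooth a).smul (hsm a)
        simp only [Finset.sum_cons]
        refine ⟨hsa.add ih.1, ?_⟩
        rw [hadd _ _ _ hUV hsub hx' hsa ih.1, ih.2,
          hsmul _ _ _ hUV hsub hx' (hsm a) (he.smooth a)]
        rfl
    rw [← (hs Finset.univ).2]
    refine hcongr _ _ _ hUV hsub hx' (hs Finset.univ).1 fun y hy ↦ ?_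
    rw [Finset.sum_apply]
    exact (he.sum_inner_smul hy (Z y)).symm
  rw [key X hX, key Y hY, hXY]

theorem curv_add_left (hU : IsOpen U) {X' : Π x : M, TangentSpace I x} (hX : SmoothField U X)
    (hX' : SmoothField U X') (hZ : SmoothField U Z) (hx : x ∈ U) :
    curv (X + X') Y Z x = curv X Y Z x + curv X' Y Z x := by
  simp only [curv_apply]
  have h1 : nabla Y (nabla (X + X') Z) x = nabla Y (nabla X Z + nabla X' Z) x :=
    nabla_congr hU ((hX.smooth_nabla hU hZ).add (hX'.smooth_nabla hU hZ))
      (fun y _ ↦ nabla_add_left) hx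
  have h2 : nabla (br (X + X') Y) Z x = nabla (br X Y + br X' Y) Z x :=
    nabla_congr_left (br_add_left hU hX hX' hx)
  rw [h1, h2, nabla_add_left, nabla_add_left, nabla_add hU (hX.smooth_nabla hU hZ)
    (hX'.smooth_nabla hU hZ) hx]
  abel

theorem curv_smul_left (hU : IsOpen U) (hf : SmoothFun I U f) (hX : SmoothField U X)
    (hZ : SmoothField U Z) (hx : x ∈ U) :
    curv (f • X) Y Z x = f x • curv X Y Z x := by
  simp only [curv_apply]
  have h1 : nabla Y (nabla (f • X) Z) x = nabla Y (f • nabla X Z) x :=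
    nabla_congr hU ((hX.smooth_nabla hU hZ).smul hf) (fun y _ ↦ nabla_smul_left) hx
  have h2 : nabla (br (f • X) Y) Z x = nabla (f • br X Y - der Y f • X) Z x :=
    nabla_congr_left (by rw [br_smul_left hU hf hX hx]; simp; abel)
  rw [h1, h2, nabla_smul_left, nabla_sub_left, nabla_smul_left, nabla_smul_left,
    nabla_smul hU hf (hX.smooth_nabla hU hZ) hx, smul_sub, smul_sub]
  abel

theorem curv_congr_left (hU : IsOpen U) {X' : Π x : M, TangentSpace I x} (hX : SmoothField U X)
    (hX' : SmoothField U X') (hZ : SmoothField U Z) (hx : x ∈ U) (h : X x = X' x) :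
    curv X Y Z x = curv X' Y Z x := by
  refine eq_of_tensorial hU hx (fun X ↦ curv X Y Z x) ?_ ?_ ?_ hX hX' h
  · intro V A B hV hVU hxV hA hB
    exact curv_add_left hV hA hB (hZ.mono hVU) hxV
  · intro V f A hV hVU hxV hf hA
    exact curv_smul_left hV hf hA (hZ.mono hVU) hxV
  · intro V A B hV hVU hxV hA hAB
    simp only [curv_apply]
    rw [nabla_congr_left (hAB x hxV), nabla_congr_left (br_congr hV hAB (fun _ _ ↦ rfl) hxV),
      nabla_congr hV (hA.smooth_nabla hV (hZ.mono hVU)) (fun y hy ↦ nabla_congr_left (hAB y hy))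
        hxV]

theorem eq_of_ip_eq (hU : IsOpen U) (hx : x ∈ U) {v w : TangentSpace I x}
    (h : ∀ (V : Set M) (W : Π x : M, TangentSpace I x), IsOpen V → V ⊆ U → x ∈ V →
      SmoothField V W → inner ℝ v (W x) = inner ℝ w (W x)) : v = w := by
  obtain ⟨V, e, hV, hxV, he⟩ := exists_isOrthonormalFrame (I := I) x
  have hUV := hU.inter hV
  rw [← he.sum_inner_smul hxV v, ← he.sum_inner_smul hxV w]
  refine Finset.sum_congr rfl fun i _ ↦ ?_
  have := h (U ∩ V) (e i) hUV inter_subset_left ⟨hx, hxV⟩ ((he.smooth i).mono inter_subset_right)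
  rw [real_inner_comm, this, real_inner_comm]

/-- The value of `R(X,Y)Z` at `x` depends only on the values of the fields at `x`. For `Z` this
follows from the case of `X` by pair symmetry. -/
theorem curv_congr (hU : IsOpen U) {X' Y' Z' : Π x : M, TangentSpace I x} (hX : SmoothField U X)
    (hX' : SmoothField U X') (hY : SmoothField U Y) (hY' : SmoothField U Y') (hZ : SmoothField U Z)
    (hZ' : SmoothField U Z') (hx : x ∈ U) (h1 : X x = X' x) (h2 : Y x = Y' x) (h3 : Z x = Z' x) :
    curv X Y Z x = curv X' Y' Z' x := by
  rw [curv_congr_left hU hX hX' hZ hx h1, curv_swap, curv_congr_left hU hY hY' hZ hx h2,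
    ← curv_swap]
  refine eq_of_ip_eq hU hx fun V W hV hVU hxV hW ↦ ?_
  have a1 := ip_curv_pair hV (hX'.mono hVU) (hY'.mono hVU) (hZ.mono hVU) hW hxV
  have a2 := ip_curv_pair hV (hX'.mono hVU) (hY'.mono hVU) (hZ'.mono hVU) hW hxV
  have a3 := curv_congr_left (Y := W) hV (hZ.mono hVU) (hZ'.mono hVU) (hX'.mono hVU) hxV h3
  simp only [ip] at a1 a2
  rw [a1, a2, a3]

theorem exists_smoothField_extend (v : TangentSpace I x) :
    ∃ V : Set M, IsOpen V ∧ x ∈ V ∧ SmoothField V (FiberBundle.extend E v) := by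
  obtain ⟨s, hs, h⟩ := FiberBundle.exists_contMDiffOn_extend (k := ∞) I E v
  obtain ⟨V, hV, hVo, hxV⟩ := mem_nhds_iff.1 hs
  exact ⟨V, hVo, hxV, h.mono hV⟩

/-- The curvature tensor is computed by arbitrary smooth extensions. -/
theorem curvature_eq (hU : IsOpen U) (hX : SmoothField U X) (hY : SmoothField U Y)
    (hZ : SmoothField U Z) (hx : x ∈ U) :
    curvature I x (X x) (Y x) (Z x) = curv X Y Z x := by
  obtain ⟨V1, hV1, hx1, h1⟩ := exists_smoothField_extend (X x)
  obtain ⟨V2, hV2, hx2, h2⟩ := exists_smoothField_extend (Y x)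
  obtain ⟨V3, hV3, hx3, h3⟩ := exists_smoothField_extend (Z x)
  have hV := (((hV1.inter hV2).inter hV3).inter hU)
  have e : curvature I x (X x) (Y x) (Z x) = curv (FiberBundle.extend E (X x))
      (FiberBundle.extend E (Y x)) (FiberBundle.extend E (Z x)) x := by
    simp [curvature, curv_apply, nabla, br]
    rfl
  rw [e]
  exact curv_congr hV (h1.mono fun y hy ↦ hy.1.1.1) (hX.mono fun y hy ↦ hy.2)
    (h2.mono fun y hy ↦ hy.1.1.2) (hY.mono fun y hy ↦ hy.2) (h3.mono fun y hy ↦ hy.1.2)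
    (hZ.mono fun y hy ↦ hy.2) ⟨⟨⟨hx1, hx2⟩, hx3⟩, hx⟩ (by simp) (by simp) (by simp)

/-! ### The second Bianchi identity -/

/-- Second Bianchi identity, in the form of the Jacobi identity for the commutators of the operators
`∇_X`, `∇_Y`, `∇_Z`: the terms `R(∇_X Y, Z)` of `∇R` are collected into Lie brackets. -/
theorem curv_bianchi_second (hU : IsOpen U) (hX : SmoothField U X) (hY : SmoothField U Y)
    (hZ : SmoothField U Z) (hW : SmoothField U W) (hx : x ∈ U) :
    (nabla X (curv Y Z W) x - curv Y Z (nabla X W) x + curv X (br Y Z) W x)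
      + (nabla Y (curv Z X W) x - curv Z X (nabla Y W) x + curv Y (br Z X) W x)
      + (nabla Z (curv X Y W) x - curv X Y (nabla Z W) x + curv Z (br X Y) W x) = 0 := by
  have key : ∀ A B C : Π x : M, TangentSpace I x, SmoothField U A → SmoothField U B →
      SmoothField U C → nabla A (curv B C W) x = nabla A (nabla B (nabla C W)) x
        - nabla A (nabla C (nabla B W)) x - nabla A (nabla (br B C) W) x := by
    intro A B C hA hB hC
    have h1 := hB.smooth_nabla hU (hC.smooth_nabla hU hW)
    have h2 := hC.smooth_nabla hU (hB.smooth_nabla hU hW)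
    have h3 := (hB.smooth_br hU hC).smooth_nabla hU hW
    rw [← nabla_sub hU h1 h2 hx, ← nabla_sub hU (h1.sub h2) h3 hx]
    rfl
  have h4 := br_jacobi_cyclic hU hX hY hZ hx
  have h7 : nabla (br X (br Y Z)) W x + nabla (br Y (br Z X)) W x + nabla (br Z (br X Y)) W x
      = 0 := by
    rw [← nabla_add_left, ← nabla_add_left]
    have : (br X (br Y Z) + br Y (br Z X) + br Z (br X Y)) x = 0 := by
      simpa using h4
    simp [nabla, this]
  rw [key X Y Z hX hY hZ, key Y Z X hY hZ hX, key Z X Y hZ hX hY]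
  simp only [curv_apply]
  rw [← neg_eq_zero, ← h7]
  abel

end

/-! ### The Riemann and Ricci tensors and the scalar curvature -/

/-- The curvature tensor in covariant form, `g(R(u,v)w, z)`. -/
def riem (x : M) (u v w z : TangentSpace I x) : ℝ :=
  inner ℝ (curvature I x u v w) z

section

variable [Nontrivial E] {u u' v w z : TangentSpace I x}

theorem riem_eq (hU : IsOpen U) (hX : SmoothField U X) (hY : SmoothField U Y)
    (hZ : SmoothField U Z) (hx : x ∈ U) :
    riem x (X x) (Y x) (Z x) (W x) = ip (curv X Y Z) W x := by
  rw [riem, curvature_eq hU hX hY hZ hx]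
  rfl

/-- Four tangent vectors at a point extend to smooth fields on a common neighbourhood. -/
theorem exists_common_extension (v : Fin 4 → TangentSpace I x) :
    ∃ (V : Set M) (X : Fin 4 → Π x : M, TangentSpace I x), IsOpen V ∧ x ∈ V ∧
      (∀ i, SmoothField V (X i)) ∧ ∀ i, X i x = v i := by
  choose V hV hxV hs using fun i ↦ exists_smoothField_extend (v i)
  exact ⟨⋂ i, V i, fun i ↦ FiberBundle.extend E (v i), isOpen_iInter_of_finite hV,
    mem_iInter.2 hxV, fun i ↦ (hs i).mono (iInter_subset _ _), fun i ↦ by simp⟩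

theorem riem_swap_left : riem x u v w z = - riem x v u w z := by
  obtain ⟨V, X, hV, hx, hX, h⟩ := exists_common_extension ![u, v, w, z]
  obtain ⟨rfl, rfl, rfl, rfl⟩ : X 0 x = u ∧ X 1 x = v ∧ X 2 x = w ∧ X 3 x = z :=
    ⟨h 0, h 1, h 2, h 3⟩
  rw [riem_eq hV (hX _) (hX _) (hX _) hx, riem_eq hV (hX _) (hX _) (hX _) hx]
  simp only [ip]
  rw [curv_swap, inner_neg_left]

theorem riem_swap_right : riem x u v w z = - riem x u v z w := by
  obtain ⟨V, X, hV, hx, hX, h⟩ := exists_common_extension ![u, v, w, z]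
  obtain ⟨rfl, rfl, rfl, rfl⟩ : X 0 x = u ∧ X 1 x = v ∧ X 2 x = w ∧ X 3 x = z :=
    ⟨h 0, h 1, h 2, h 3⟩
  rw [riem_eq hV (hX _) (hX _) (hX _) hx, riem_eq hV (hX _) (hX _) (hX _) hx]
  exact ip_curv_skew hV (hX _) (hX _) (hX _) (hX _) hx

theorem riem_pair : riem x u v w z = riem x w z u v := by
  obtain ⟨V, X, hV, hx, hX, h⟩ := exists_common_extension ![u, v, w, z]
  obtain ⟨rfl, rfl, rfl, rfl⟩ : X 0 x = u ∧ X 1 x = v ∧ X 2 x = w ∧ X 3 x = z :=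
    ⟨h 0, h 1, h 2, h 3⟩
  rw [riem_eq hV (hX _) (hX _) (hX _) hx, riem_eq hV (hX _) (hX _) (hX _) hx]
  exact ip_curv_pair hV (hX _) (hX _) (hX _) (hX _) hx

theorem riem_add_last (z' : TangentSpace I x) :
    riem x u v w (z + z') = riem x u v w z + riem x u v w z' := inner_add_right ..

theorem riem_smul_last (c : ℝ) : riem x u v w (c • z) = c * riem x u v w z :=
  real_inner_smul_right ..

/-- The covariant curvature tensor as a linear form in its first argument. -/
def riemₗ (x : M) (v w z : TangentSpace I x) : TangentSpace I x →ₗ[ℝ] ℝ where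
  toFun u := riem x u v w z
  map_add' u u' := by
    have h : ∀ u : TangentSpace I x, riem x u v w z = riem x z w v u := fun u ↦ by
      rw [riem_pair, riem_swap_left, riem_swap_right, neg_neg]
    simp only [h, riem_add_last]
  map_smul' c u := by
    have h : ∀ u : TangentSpace I x, riem x u v w z = riem x z w v u := fun u ↦ by
      rw [riem_pair, riem_swap_left, riem_swap_right, neg_neg]
    simp only [h, riem_smul_last, RingHom.id_apply, smul_eq_mul]

theorem riem_sub_first : riem x (u - u') v w z = riem x u v w z - riem x u' v w z :=
  map_sub (riemₗ x v w z) u u'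

theorem riem_smul_first (c : ℝ) : riem x (c • u) v w z = c * riem x u v w z :=
  map_smul (riemₗ x v w z) c u

theorem riem_sub_second : riem x v (u - u') w z = riem x v u w z - riem x v u' w z := by
  rw [riem_swap_left, riem_sub_first, riem_swap_left, riem_swap_left (u := u')]
  ring

theorem riem_smul_second (c : ℝ) : riem x v (c • u) w z = c * riem x v u w z := by
  rw [riem_swap_left, riem_smul_first, riem_swap_left (u := u)]
  ring

/-- The bilinear form `(u, z) ↦ g(R(u,v)w, z)` whose metric trace is `S(v,w)`. -/
def riemForm (x : M) (v w : TangentSpace I x) : TangentSpace I x →ₗ[ℝ] TangentSpace I x →ₗ[ℝ] ℝ :=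
  LinearMap.mk₂ ℝ (fun u z ↦ riem x u v w z) (fun u u' z ↦ map_add (riemₗ x v w z) u u')
    (fun c u z ↦ map_smul (riemₗ x v w z) c u) (fun _ _ _ ↦ riem_add_last _)
    (fun _ _ _ ↦ riem_smul_last _)

theorem riemForm_apply : riemForm x v w u z = riem x u v w z := rfl

/-- The metric trace of a bilinear form does not depend on the orthonormal basis. -/
theorem sum_bilin_eq {V ι κ : Type*} [NormedAddCommGroup V] [InnerProductSpace ℝ V] [Fintype ι]
    [Fintype κ] (B : V →ₗ[ℝ] V →ₗ[ℝ] ℝ) (b : OrthonormalBasis ι ℝ V)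
    (c : OrthonormalBasis κ ℝ V) : ∑ i, B (b i) (b i) = ∑ i, B (c i) (c i) := by
  classical
  have h : ∀ i, B (b i) (b i) = ∑ j, ∑ k, inner ℝ (c j) (b i) * inner ℝ (c k) (b i)
      * B (c j) (c k) := by
    intro i
    conv_lhs => rw [← c.sum_repr' (b i)]
    simp only [map_sum, LinearMap.sum_apply, map_smul, LinearMap.smul_apply, smul_eq_mul,
      Finset.mul_sum, mul_assoc]
    rw [Finset.sum_comm]
    exact Finset.sum_congr rfl fun j _ ↦ Finset.sum_congr rfl fun k _ ↦ by ring
  simp_rw [h]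
  rw [Finset.sum_comm]
  refine Finset.sum_congr rfl fun j _ ↦ ?_
  rw [Finset.sum_comm]
  rw [Finset.sum_eq_single j]
  · rw [← Finset.sum_mul]
    have : ∑ i, inner ℝ (c j) (b i) * inner ℝ (c j) (b i) = (1 : ℝ) := by
      have := b.sum_inner_mul_inner (c j) (c j)
      simp_rw [real_inner_comm (c j)] at this ⊢
      rw [this]
      simp
    rw [this, one_mul]
  · intro k _ hk
    rw [← Finset.sum_mul]
    have : ∑ i, inner ℝ (c j) (b i) * inner ℝ (c k) (b i) = (0 : ℝ) := by
      have := b.sum_inner_mul_inner (c j) (c k)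
      simp_rw [real_inner_comm (b _) (c k)] at this ⊢
      simp_rw [real_inner_comm (c k) (b _)] at this ⊢
      rw [this]
      exact c.orthonormal.2 (Ne.symm hk)
    rw [this, zero_mul]
  · simp

/-- An infinitesimal rotation `b i ↦ d i` of an orthonormal basis does not change the metric trace
of a bilinear form. -/
theorem sum_bilin_skew {V ι : Type*} [NormedAddCommGroup V] [InnerProductSpace ℝ V] [Fintype ι]
    (B : V →ₗ[ℝ] V →ₗ[ℝ] ℝ) (b : OrthonormalBasis ι ℝ V) (d : ι → V)
    (hd : ∀ i j, inner ℝ (d i) (b j) + inner ℝ (b i) (d j) = (0 : ℝ)) :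
    ∑ i, (B (d i) (b i) + B (b i) (d i)) = 0 := by
  have h1 : ∀ i, B (d i) (b i) = ∑ j, inner ℝ (b j) (d i) * B (b j) (b i) := by
    intro i
    conv_lhs => rw [← b.sum_repr' (d i)]
    simp [map_sum]
  have h2 : ∀ i, B (b i) (d i) = ∑ j, inner ℝ (b j) (d i) * B (b i) (b j) := by
    intro i
    conv_lhs => rw [← b.sum_repr' (d i)]
    simp [map_sum]
  simp_rw [h1, h2]
  rw [Finset.sum_add_distrib, Finset.sum_comm, ← Finset.sum_add_distrib]
  refine Finset.sum_eq_zero fun i _ ↦ ?_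
  rw [← Finset.sum_add_distrib]
  refine Finset.sum_eq_zero fun j _ ↦ ?_
  have := hd j i
  rw [real_inner_comm] at this
  linear_combination B (b i) (b j) * this

variable {ι : Type*} [Fintype ι]

theorem ricci_eq_sum (b : OrthonormalBasis ι ℝ (TangentSpace I x)) :
    ricci I x v w = ∑ i, riem x (b i) v w (b i) :=
  sum_bilin_eq (riemForm x v w) (stdOrthonormalBasis ℝ (TangentSpace I x)) b

theorem ricci_comm : ricci I x v w = ricci I x w v := by
  rw [ricci_eq_sum (stdOrthonormalBasis ℝ _), ricci_eq_sum (stdOrthonormalBasis ℝ _)]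
  refine Finset.sum_congr rfl fun i _ ↦ ?_
  rw [riem_pair, riem_swap_left, riem_swap_right, neg_neg]

theorem ricci_add_right (w' : TangentSpace I x) :
    ricci I x v (w + w') = ricci I x v w + ricci I x v w' := by
  simp only [ricci_eq_sum (stdOrthonormalBasis ℝ (TangentSpace I x)), ← Finset.sum_add_distrib]
  refine Finset.sum_congr rfl fun i _ ↦ ?_
  simp only [riem_pair (w := _ + _), riem_pair (w := w), riem_pair (w := w')]
  exact map_add (riemₗ x _ _ _) w w'

theorem ricci_smul_right (c : ℝ) : ricci I x v (c • w) = c * ricci I x v w := by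
  simp only [ricci_eq_sum (stdOrthonormalBasis ℝ (TangentSpace I x)), Finset.mul_sum]
  refine Finset.sum_congr rfl fun i _ ↦ ?_
  simp only [riem_pair (w := _ • _), riem_pair (w := w)]
  exact map_smul (riemₗ x _ _ _) c w

/-- The Ricci tensor as a bilinear form. -/
def ricciForm (x : M) : TangentSpace I x →ₗ[ℝ] TangentSpace I x →ₗ[ℝ] ℝ :=
  LinearMap.mk₂ ℝ (fun v w ↦ ricci I x v w)
    (fun v v' w ↦ by simp only [ricci_comm (w := w), ricci_add_right])
    (fun c v w ↦ by simp only [ricci_comm (w := w), ricci_smul_right, smul_eq_mul])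
    (fun _ _ _ ↦ ricci_add_right _) (fun _ _ _ ↦ ricci_smul_right _)

theorem ricciForm_apply : ricciForm x v w = ricci I x v w := rfl

theorem ricci_sub_left : ricci I x (u - u') w = ricci I x u w - ricci I x u' w :=
  LinearMap.congr_fun (map_sub (ricciForm x) u u') w

theorem ricci_smul_left (c : ℝ) : ricci I x (c • u) w = c * ricci I x u w :=
  LinearMap.congr_fun (map_smul (ricciForm x) c u) w

theorem scalarCurvature_eq_sum (b : OrthonormalBasis ι ℝ (TangentSpace I x)) :
    scalarCurvature I x = ∑ i, ricci I x (b i) (b i) := by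
  exact sum_bilin_eq (ricciForm x) (stdOrthonormalBasis ℝ (TangentSpace I x)) b

theorem smooth_riem (hU : IsOpen U) (hX : SmoothField U X) (hY : SmoothField U Y)
    (hZ : SmoothField U Z) (hW : SmoothField U W) :
    SmoothFun I U fun y ↦ riem y (X y) (Y y) (Z y) (W y) :=
  ((smooth_curv hU hX hY hZ).smooth_ip hW).congr fun _ hy ↦ riem_eq hU hX hY hZ hy

theorem smooth_ricci (hU : IsOpen U) (hX : SmoothField U X) (hY : SmoothField U Y) :
    SmoothFun I U fun y ↦ ricci I y (X y) (Y y) := by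
  intro x hx
  obtain ⟨V, e, hV, hxV, he⟩ := exists_isOrthonormalFrame (I := I) x
  have hUV := hU.inter hV
  replace he := he.mono (inter_subset_right (s := U))
  have h1 : SmoothFun I (U ∩ V) fun y ↦ ∑ i, riem y (e i y) (X y) (Y y) (e i y) :=
    contMDiffOn_finsetSum fun i _ ↦ smooth_riem hUV (he.smooth i) (hX.mono inter_subset_left)
      (hY.mono inter_subset_left) (he.smooth i)
  refine (ContMDiffOn.contMDiffAt (h1.congr fun y hy ↦ ?_)
    (hUV.mem_nhds ⟨hx, hxV⟩)).contMDiffWithinAt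
  simp [ricci_eq_sum (he.basis hy)]

theorem smooth_scalarCurvature : ContMDiff I 𝓘(ℝ) ∞ (scalarCurvature I : M → ℝ) := by
  intro x
  obtain ⟨V, e, hV, hxV, he⟩ := exists_isOrthonormalFrame (I := I) x
  have h1 : SmoothFun I V fun y ↦ ∑ i, ricci I y (e i y) (e i y) :=
    contMDiffOn_finsetSum fun i _ ↦ smooth_ricci hV (he.smooth i) (he.smooth i)
  refine ContMDiffOn.contMDiffAt (h1.congr fun y hy ↦ ?_) (hV.mem_nhds hxV)
  simp [scalarCurvature_eq_sum (he.basis hy)]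

end

/-! ### Unit fields with the covariant derivative of a Kenmotsu structure -/

/-- A unit vector field with `∇_v ζ = v - g(v,ζ) ζ`, as the characteristic field of a Kenmotsu
structure; nothing else about `φ` and `η` enters the curvature identities. -/
structure IsKenmotsuField (ζ : Π x : M, TangentSpace I x) : Prop where
  smooth : SmoothField univ ζ
  unit : ∀ x, inner ℝ (ζ x) (ζ x) = (1 : ℝ)
  nabla_eq : ∀ x v, leviCivita I ζ x v = v - (inner ℝ v (ζ x) : ℝ) • ζ x

theorem SmoothField.zero : SmoothField U (0 : Π x : M, TangentSpace I x) := by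
  intro x hx
  obtain ⟨V, e, hV, hxV, he⟩ := exists_isOrthonormalFrame (I := I) x
  have h : SmoothField V (∑ i ∈ (∅ : Finset (Fin (Module.finrank ℝ E))), (e i)) :=
    (ContMDiffOn.sum_section (s := ∅) fun i hi ↦ he.smooth i).congr fun y _ ↦ by simp
  rw [Finset.sum_empty] at h
  exact (h.contMDiffAt hV hxV).contMDiffWithinAt

theorem nabla_neg (hU : IsOpen U) (hY : SmoothField U Y) (hx : x ∈ U) :
    nabla X (-Y) x = - nabla X Y x := by
  have h0 : nabla X 0 x = 0 := by
    simp [nabla, (leviCivita I (M := M)).zero]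
  have := nabla_sub (X := X) hU SmoothField.zero hY hx
  rwa [zero_sub, h0, zero_sub] at this

theorem der_add (hU : IsOpen U) (hf : SmoothFun I U f) (hg : SmoothFun I U g) (hx : x ∈ U) :
    der X (fun y ↦ f y + g y) x = der X f x + der X g x := by
  have := mvfderiv_fun_add (hf.mdifferentiableAt hU hx) (hg.mdifferentiableAt hU hx)
  exact congr($this (X x))

theorem der_sub (hU : IsOpen U) (hf : SmoothFun I U f) (hg : SmoothFun I U g) (hx : x ∈ U) :
    der X (fun y ↦ f y - g y) x = der X f x - der X g x := by
  have := mvfderiv_fun_sub (hf.mdifferentiableAt hU hx) (hg.mdifferentiableAt hU hx)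
  exact congr($this (X x))

theorem der_mul (hU : IsOpen U) (hf : SmoothFun I U f) (hg : SmoothFun I U g) (hx : x ∈ U) :
    der X (fun y ↦ f y * g y) x = f x * der X g x + g x * der X f x := by
  have := mvfderiv_fun_mul (hf.mdifferentiableAt hU hx) (hg.mdifferentiableAt hU hx)
  exact congr($this (X x))

theorem der_const (c : ℝ) : der X (fun _ ↦ c) x = 0 := by
  simp [der, mvfderiv_const]

theorem der_const_mul (hU : IsOpen U) (c : ℝ) (hf : SmoothFun I U f) (hx : x ∈ U) :
    der X (fun y ↦ c * f y) x = c * der X f x := by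
  rw [der_mul hU contMDiffOn_const hf hx, der_const, mul_zero, add_zero]

theorem der_sum {ι : Type*} {F : ι → M → ℝ} (s : Finset ι) (hU : IsOpen U)
    (hF : ∀ i, SmoothFun I U (F i)) (hx : x ∈ U) :
    der X (fun y ↦ ∑ i ∈ s, F i y) x = ∑ i ∈ s, der X (F i) x := by
  induction s using Finset.cons_induction with
  | empty => simpa using der_const 0
  | cons a s ha ih =>
    simp only [Finset.sum_cons]
    rw [der_add hU (hF a) (contMDiffOn_finsetSum fun i _ ↦ hF i) hx, ih]

/-- The covariant derivative of an orthonormal frame is skew. -/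
theorem IsOrthonormalFrame.inner_nabla_skew {ι : Type*} {e : ι → Π x : M, TangentSpace I x}
    (he : IsOrthonormalFrame U e) (hU : IsOpen U) (hX : SmoothField U X) (hx : x ∈ U) (i j : ι) :
    inner ℝ (nabla X (e i) x) (e j x) + inner ℝ (e i x) (nabla X (e j) x) = (0 : ℝ) := by
  classical
  have h := der_ip hU hX (he.smooth i) (he.smooth j) hx
  rw [der_congr hU (f := ip (e i) (e j)) (g := fun _ ↦ if i = j then 1 else 0)
    (fun y hy ↦ orthonormal_iff_ite.1 (he.orthonormal y hy) i j) hx, der_const] at h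
  exact h.symm

namespace IsKenmotsuField

variable {ζ : Π x : M, TangentSpace I x} (hζ : IsKenmotsuField ζ)

include hζ

theorem smoothOn : SmoothField U ζ := hζ.smooth.mono (subset_univ U)

theorem nabla_zeta : nabla X ζ x = X x - (inner ℝ (X x) (ζ x) : ℝ) • ζ x := hζ.nabla_eq x (X x)

theorem nabla_zeta_zeta : nabla ζ ζ x = 0 := by
  rw [hζ.nabla_zeta, hζ.unit, one_smul, sub_self]

theorem der_ip_zeta (hU : IsOpen U) (hX : SmoothField U X) (hY : SmoothField U Y) (hx : x ∈ U) :
    der X (ip Y ζ) x = inner ℝ (nabla X Y x) (ζ x) + inner ℝ (X x) (Y x)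
      - inner ℝ (X x) (ζ x) * inner ℝ (Y x) (ζ x) := by
  rw [der_ip hU hX hY hζ.smoothOn hx]
  simp only [ip, hζ.nabla_zeta, inner_sub_right, inner_smul_right]
  rw [real_inner_comm (X x) (Y x)]
  ring

variable [Nontrivial E] {u v w z : TangentSpace I x}

/-- `R(X,Y)ζ = η(X)Y - η(Y)X`. -/
theorem curv_zeta (hU : IsOpen U) (hX : SmoothField U X) (hY : SmoothField U Y) (hx : x ∈ U) :
    curv X Y ζ x = (inner ℝ (X x) (ζ x) : ℝ) • Y x - (inner ℝ (Y x) (ζ x) : ℝ) • X x := by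
  have key : ∀ A B : Π x : M, TangentSpace I x, SmoothField U A → SmoothField U B →
      nabla A (nabla B ζ) x = nabla A B x - ((inner ℝ (B x) (ζ x) : ℝ) •
        (A x - (inner ℝ (A x) (ζ x) : ℝ) • ζ x)
        + ((inner ℝ (nabla A B x) (ζ x) : ℝ) + inner ℝ (A x) (B x)
      - inner ℝ (A x) (ζ x) * inner ℝ (B x) (ζ x)) • ζ x) := by
    intro A B hA hB
    have hs : SmoothFun I U (ip B ζ) := hB.smooth_ip hζ.smoothOn
    have h1 : nabla A (nabla B ζ) x = nabla A (B - ip B ζ • ζ) x :=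
      nabla_congr hU (hB.sub (hζ.smoothOn.smul hs)) (fun y _ ↦ hζ.nabla_zeta) hx
    rw [h1, nabla_sub hU hB (hζ.smoothOn.smul hs) hx, nabla_smul hU hs hζ.smoothOn hx,
      hζ.nabla_zeta, hζ.der_ip_zeta hU hA hB hx]
    rfl
  rw [curv_apply, key X Y hX hY, key Y X hY hX, hζ.nabla_zeta, ← nabla_torsion hU hX hY hx,
    inner_sub_left, real_inner_comm (X x) (Y x)]
  module

theorem riem_zeta_third : riem x u v (ζ x) z
    = inner ℝ u (ζ x) * inner ℝ v z - inner ℝ v (ζ x) * inner ℝ u z := by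
  obtain ⟨V, X, hV, hx, hX, h⟩ := exists_common_extension ![u, v, z, z]
  obtain ⟨rfl, rfl, rfl⟩ : X 0 x = u ∧ X 1 x = v ∧ X 2 x = z := ⟨h 0, h 1, h 2⟩
  rw [riem_eq hV (hX _) (hX _) hζ.smoothOn hx]
  simp only [ip]
  rw [hζ.curv_zeta hV (hX _) (hX _) hx, inner_sub_left, real_inner_smul_left, real_inner_smul_left]

theorem riem_zeta_first : riem x (ζ x) v w z
    = inner ℝ w (ζ x) * inner ℝ v z - inner ℝ v w * inner ℝ z (ζ x) := by
  rw [riem_pair, hζ.riem_zeta_third, real_inner_comm v z, real_inner_comm v w]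
  ring

theorem riem_zeta_second : riem x u (ζ x) w z
    = - (inner ℝ w (ζ x) * inner ℝ u z - inner ℝ u w * inner ℝ z (ζ x)) := by
  rw [riem_swap_left, hζ.riem_zeta_first]

theorem curv_zeta_first (hU : IsOpen U) (hY : SmoothField U Y) (hW : SmoothField U W)
    (hx : x ∈ U) :
    curv ζ Y W x = (inner ℝ (W x) (ζ x) : ℝ) • Y x - (inner ℝ (Y x) (W x) : ℝ) • ζ x := by
  refine ext_inner_right ℝ fun z ↦ ?_
  have := hζ.riem_zeta_first (v := Y x) (w := W x) (z := z)
  rw [riem, curvature_eq hU hζ.smoothOn hY hW hx] at this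
  rw [this, inner_sub_left, real_inner_smul_left, real_inner_smul_left, real_inner_comm z (ζ x)]

/-- The derivative of `R(ζ,Y)W = η(W)Y - g(Y,W)ζ` in which only `ζ` is differentiated. -/
theorem nabla_curv_zeta_first (hU : IsOpen U) (hX : SmoothField U X) (hY : SmoothField U Y)
    (hW : SmoothField U W) (hx : x ∈ U) :
    nabla X (curv ζ Y W) x = curv ζ (nabla X Y) W x + curv ζ Y (nabla X W) x
      + (inner ℝ (X x) (W x) - inner ℝ (X x) (ζ x) * inner ℝ (W x) (ζ x) : ℝ) • Y x
      - (inner ℝ (Y x) (W x) : ℝ) • (X x - (inner ℝ (X x) (ζ x) : ℝ) • ζ x) := by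
  have h1 : SmoothFun I U (ip W ζ) := hW.smooth_ip hζ.smoothOn
  have h2 : SmoothFun I U (ip Y W) := hY.smooth_ip hW
  have e : nabla X (curv ζ Y W) x = nabla X (ip W ζ • Y - ip Y W • ζ) x :=
    nabla_congr hU ((hY.smul h1).sub (hζ.smoothOn.smul h2))
      (fun y hy ↦ hζ.curv_zeta_first hU hY hW hy) hx
  rw [e, nabla_sub hU (hY.smul h1) (hζ.smoothOn.smul h2) hx, nabla_smul hU h1 hY hx,
    nabla_smul hU h2 hζ.smoothOn hx, hζ.der_ip_zeta hU hX hW hx, der_ip hU hX hY hW hx,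
    hζ.curv_zeta_first hU (hX.smooth_nabla hU hY) hW hx,
    hζ.curv_zeta_first hU hY (hX.smooth_nabla hU hW) hx, hζ.nabla_zeta]
  simp only [ip]
  module

/-- `(∇_ζ R)(X,Y)W = -2 R(X,Y)W + 2 (g(X,W) Y - g(Y,W) X)`: the second Bianchi identity moves the
derivative to the terms `R(ζ,·)·`, which are explicit. -/
theorem der_zeta_riem (hU : IsOpen U) {T : Π x : M, TangentSpace I x} (hX : SmoothField U X)
    (hY : SmoothField U Y) (hW : SmoothField U W) (hT : SmoothField U T) (hx : x ∈ U) :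
    der ζ (fun y ↦ riem y (X y) (Y y) (W y) (T y)) x
      = riem x (nabla ζ X x) (Y x) (W x) (T x) + riem x (X x) (nabla ζ Y x) (W x) (T x)
        + riem x (X x) (Y x) (nabla ζ W x) (T x) + riem x (X x) (Y x) (W x) (nabla ζ T x)
        - 2 * riem x (X x) (Y x) (W x) (T x)
        + 2 * (inner ℝ (X x) (W x) * inner ℝ (Y x) (T x)
          - inner ℝ (Y x) (W x) * inner ℝ (X x) (T x)) := by
  have hZ : SmoothField U ζ := hζ.smoothOn
  have hc : SmoothField U (curv X Y W) := smooth_curv hU hX hY hW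
  rw [der_congr hU (fun y hy ↦ riem_eq hU hX hY hW hy) hx, der_ip hU hZ hc hT hx]
  have hB := curv_bianchi_second hU hZ hX hY hW hx
  have n1 : nabla X (curv Y ζ W) x = - nabla X (curv ζ Y W) x := by
    rw [← nabla_neg hU (smooth_curv hU hZ hY hW) hx]
    exact nabla_congr hU ((smooth_curv hU hY hZ hW).congr fun y _ ↦ curv_swap.symm)
      (fun y _ ↦ curv_swap) hx
  have n2 : curv Y ζ (nabla X W) x = - curv ζ Y (nabla X W) x := curv_swap
  rw [n1, n2, hζ.nabla_curv_zeta_first hU hX hY hW hx, hζ.nabla_curv_zeta_first hU hY hX hW hx]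
    at hB
  have hB' := congr(inner ℝ $hB (T x))
  simp only [inner_add_left, inner_sub_left, inner_neg_left, real_inner_smul_left,
    inner_zero_left] at hB'
  have r : ∀ A B C : Π x : M, TangentSpace I x, SmoothField U A → SmoothField U B →
      SmoothField U C → inner ℝ (curv A B C x) (T x) = riem x (A x) (B x) (C x) (T x) :=
    fun A B C hA hB hC ↦ (riem_eq hU hA hB hC hx).symm
  rw [r _ _ _ hX hY (hZ.smooth_nabla hU hW), r _ _ _ hZ (hX.smooth_br hU hY) hW,
    r _ _ _ hZ (hX.smooth_nabla hU hY) hW, r _ _ _ hX (hY.smooth_br hU hZ) hW,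
    r _ _ _ hZ (hY.smooth_nabla hU hX) hW, r _ _ _ hY (hZ.smooth_br hU hX) hW,
    r _ _ _ hZ hY (hX.smooth_nabla hU hW), r _ _ _ hZ hX (hY.smooth_nabla hU hW),
    ← nabla_torsion hU hX hY hx, ← nabla_torsion hU hY hZ hx, ← nabla_torsion hU hZ hX hx,
    hζ.nabla_zeta, hζ.nabla_zeta] at hB'
  simp only [riem_sub_second, riem_smul_second, hζ.riem_zeta_second, hζ.riem_zeta_first,
    riem_swap_left (u := Y x), riem_sub_first, riem_smul_first] at hB'
  have e1 : ip (nabla ζ (curv X Y W)) T x = inner ℝ (nabla ζ (curv X Y W) x) (T x) := rfl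
  have e2 : ip (curv X Y W) (nabla ζ T) x = riem x (X x) (Y x) (W x) (nabla ζ T x) :=
    (riem_eq hU hX hY hW hx).symm
  rw [e1, e2]
  simp only [inner_sub_left, real_inner_comm (T x) (ζ x)] at hB'
  linear_combination hB'

/-- `S(v, ζ) = -2n η(v)` in dimension `2n + 1`. -/
theorem ricci_zeta : ricci I x v (ζ x) = (1 - Module.finrank ℝ E) * inner ℝ v (ζ x) := by
  set b := stdOrthonormalBasis ℝ (TangentSpace I x)
  rw [ricci_eq_sum b]
  simp only [hζ.riem_zeta_third, Finset.sum_sub_distrib, ← Finset.mul_sum]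
  have h1 : ∑ i, inner ℝ (b i) (ζ x) * inner ℝ v (b i) = (inner ℝ v (ζ x) : ℝ) := by
    rw [← b.sum_inner_mul_inner v (ζ x)]
    exact Finset.sum_congr rfl fun i _ ↦ mul_comm _ _
  have h2 : ∑ i, inner ℝ (b i) (b i) = (Module.finrank ℝ E : ℝ) := by
    simp [b]
    rfl
  rw [h1, h2]
  ring

/-- `(∇_ζ S)(Y,W) = -2 S(Y,W) - 4n g(Y,W)` in dimension `2n + 1`. -/
theorem der_zeta_ricci (hU : IsOpen U) (hY : SmoothField U Y) (hW : SmoothField U W)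
    (hx : x ∈ U) :
    der ζ (fun y ↦ ricci I y (Y y) (W y)) x
      = ricci I x (nabla ζ Y x) (W x) + ricci I x (Y x) (nabla ζ W x)
        - 2 * ricci I x (Y x) (W x)
        + 2 * (1 - Module.finrank ℝ E) * inner ℝ (Y x) (W x) := by
  obtain ⟨V, e, hV, hxV, he⟩ := exists_isOrthonormalFrame (I := I) x
  have hUV := hU.inter hV
  have hx' : x ∈ U ∩ V := ⟨hx, hxV⟩
  replace he := he.mono (inter_subset_right (s := U))
  replace hY := hY.mono (inter_subset_left (t := V))
  replace hW := hW.mono (inter_subset_left (t := V))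
  set b := he.basis hx' with hb
  have hbe : ∀ i, e i x = b i := fun i ↦ (he.basis_apply hx' i).symm
  rw [der_congr hUV (g := fun y ↦ ∑ i, riem y (e i y) (Y y) (W y) (e i y))
    (fun y hy ↦ by simp [ricci_eq_sum (he.basis hy)]) hx',
    der_sum _ hUV (fun i ↦ smooth_riem hUV (he.smooth i) hY hW (he.smooth i)) hx']
  simp only [hζ.der_zeta_riem hUV (he.smooth _) hY hW (he.smooth _) hx']
  have hskew := sum_bilin_skew (riemForm x (Y x) (W x)) b (fun i ↦ nabla ζ (e i) x) fun i j ↦ by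
    rw [← hbe, ← hbe]; exact he.inner_nabla_skew hUV hζ.smoothOn hx' i j
  have hsum1 : ∑ i, inner ℝ (b i) (W x) * inner ℝ (Y x) (b i) = (inner ℝ (Y x) (W x) : ℝ) := by
    rw [← b.sum_inner_mul_inner (Y x) (W x)]
    exact Finset.sum_congr rfl fun i _ ↦ mul_comm _ _
  have hsum2 : ∑ i, inner ℝ (b i) (b i) = (Module.finrank ℝ E : ℝ) := by
    simp
  simp only [ricci_eq_sum b, hbe] at *
  have e3 : ∀ i, riem x (nabla ζ (e i) x) (Y x) (W x) (b i)
      + riem x (b i) (nabla ζ Y x) (W x) (b i) + riem x (b i) (Y x) (nabla ζ W x) (b i)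
      + riem x (b i) (Y x) (W x) (nabla ζ (e i) x) - 2 * riem x (b i) (Y x) (W x) (b i)
      + 2 * (inner ℝ (b i) (W x) * inner ℝ (Y x) (b i) - inner ℝ (Y x) (W x) * inner ℝ (b i) (b i))
      = (riemForm x (Y x) (W x) (nabla ζ (e i) x) (b i)
          + riemForm x (Y x) (W x) (b i) (nabla ζ (e i) x))
        + riem x (b i) (nabla ζ Y x) (W x) (b i) + riem x (b i) (Y x) (nabla ζ W x) (b i)
        - 2 * riem x (b i) (Y x) (W x) (b i) + 2 * (inner ℝ (b i) (W x) * inner ℝ (Y x) (b i))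
        - 2 * inner ℝ (Y x) (W x) * inner ℝ (b i) (b i) := by
    intro i
    simp only [riemForm_apply]
    ring
  simp only [e3, Finset.sum_add_distrib, Finset.sum_sub_distrib, ← Finset.mul_sum, hsum1, hsum2]
  rw [Finset.sum_add_distrib] at hskew
  rw [hskew]
  ring

/-- `ζ r = -2 (r + 2n (2n+1))` in dimension `2n + 1`. -/
theorem der_zeta_scalarCurvature :
    der ζ (scalarCurvature I) x = - 2 * scalarCurvature I x
      + 2 * (1 - Module.finrank ℝ E) * Module.finrank ℝ E := by
  obtain ⟨V, e, hV, hx, he⟩ := exists_isOrthonormalFrame (I := I) x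
  set b := he.basis hx with hb
  have hbe : ∀ i, e i x = b i := fun i ↦ (he.basis_apply hx i).symm
  rw [der_congr hV (g := fun y ↦ ∑ i, ricci I y (e i y) (e i y))
    (fun y hy ↦ by simp [scalarCurvature_eq_sum (he.basis hy)]) hx,
    der_sum _ hV (fun i ↦ smooth_ricci hV (he.smooth i) (he.smooth i)) hx]
  simp only [hζ.der_zeta_ricci hV (he.smooth _) (he.smooth _) hx]
  have hskew := sum_bilin_skew (ricciForm x) b (fun i ↦ nabla ζ (e i) x) fun i j ↦ by
    rw [← hbe, ← hbe]; exact he.inner_nabla_skew hV hζ.smoothOn hx i j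
  have hsum2 : ∑ i, inner ℝ (b i) (b i) = (Module.finrank ℝ E : ℝ) := by
    simp
  simp only [scalarCurvature_eq_sum b, hbe, Finset.sum_add_distrib, Finset.sum_sub_distrib,
    ← Finset.mul_sum, hsum2, ricciForm_apply] at *
  rw [hskew]
  ring

end IsKenmotsuField

/-! ### Gradient almost Ricci–Yamabe solitons -/

section

variable [Nontrivial E]

/-- The characteristic field of a Kenmotsu structure satisfies `∇_v ζ = v - η(v) ζ`. -/
theorem IsKenmotsu.isKenmotsuField {φ : Π x : M, TangentSpace I x →L[ℝ] TangentSpace I x}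
    {ζ : Π x : M, TangentSpace I x} {η : Π x : M, TangentSpace I x →L[ℝ] ℝ}
    (hK : IsKenmotsu I φ ζ η) : IsKenmotsuField ζ where
  smooth := hK.smooth_zeta.contMDiffOn
  unit := hK.inner_zeta_self
  nabla_eq x v := by
    have hsm : SmoothField univ ζ := hK.smooth_zeta.contMDiffOn
    have hφζ : ∀ y, φ y (ζ y) = 0 := fun y ↦ by
      rw [← inner_self_eq_zero (𝕜 := ℝ), hK.inner_phi_phi, hK.eta_apply, hK.inner_zeta_self]
      ring
    have hηφ : ∀ w : TangentSpace I x, η x (φ x w) = 0 := fun w ↦ by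
      have h1 := hK.phi_phi x (φ x w)
      rw [hK.phi_phi x w, map_add, map_neg, map_smul, hφζ, smul_zero, add_zero] at h1
      have h2 : η x (φ x w) • ζ x = 0 := by simpa using h1
      have h3 := congr(inner ℝ $h2 (ζ x))
      rw [real_inner_smul_left, hK.inner_zeta_self, inner_zero_left, mul_one] at h3
      exact h3
    have h := hK.nabla_phi x v ζ (hsm.mdifferentiableAt isOpen_univ (mem_univ x))
    have h0 : leviCivita I (fun y ↦ φ y (ζ y)) x = 0 := by
      have : (fun y ↦ φ y (ζ y)) = (0 : Π x : M, TangentSpace I x) := funext hφζ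
      rw [this, (leviCivita I (M := M)).zero]
      rfl
    have hη : η x (ζ x) = 1 := by rw [hK.eta_apply, hK.inner_zeta_self]
    rw [h0, ← hK.eta_apply, hηφ, hη] at h
    have h1 : φ x (leviCivita I ζ x v) = φ x v := by simpa using h
    have h2 := congr(φ x $h1)
    rw [hK.phi_phi, hK.phi_phi] at h2
    have h3 : η x (leviCivita I ζ x v) = 0 := by
      obtain ⟨V, hV, hx, hv⟩ := exists_smoothField_extend v
      have h4 := der_ip hV hv (hsm.mono (subset_univ V)) (hsm.mono (subset_univ V)) hx
      rw [der_congr hV (f := ip ζ ζ) (g := fun _ ↦ 1) (fun y _ ↦ hK.inner_zeta_self y) hx,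
        der_const] at h4
      simp only [ip, nabla, FiberBundle.extend_apply_self] at h4
      have h5 := real_inner_comm (leviCivita I ζ x v) (ζ x)
      rw [hK.eta_apply]
      linarith
    rw [h3, zero_smul, add_zero, hK.eta_apply] at h2
    rw [← neg_inj, h2]
    abel

theorem inner_grad (v : TangentSpace I x) : inner ℝ (grad I f x) v = mvfderiv I f x v :=
  InnerProductSpace.toDual_symm_apply ..

theorem smooth_grad (hU : IsOpen U) (hf : SmoothFun I U f) : SmoothField U (grad I f) := by
  refine SmoothField.of_ip hU fun V Z hV hVU hZ ↦ ?_
  refine (hZ.smooth_der hV (ContMDiffOn.mono hf hVU)).congr fun y _ ↦ ?_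
  rw [ip_comm]
  exact inner_grad _

namespace IsKenmotsuField

variable {ζ : Π x : M, TangentSpace I x} (hζ : IsKenmotsuField ζ) {α : ℝ} {μ : M → ℝ}

include hζ

/-- The curvature term `g(R(ζ,v) ∇f, w)`, evaluated from the Kenmotsu identities and from the
soliton equation `∇²f = μ g - α S`, determines `α S`. -/
theorem ricci_of_hessian (hf : ContMDiff I 𝓘(ℝ) ∞ f) (hμ : ContMDiff I 𝓘(ℝ) ∞ μ)
    (hs : ∀ (x : M) (v w : TangentSpace I x),
      hessian I f x v w = μ x * inner ℝ v w - α * ricci I x v w) (v w : TangentSpace I x) :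
    α * ricci I x v w = (mvfderiv I f x (ζ x) - mvfderiv I μ x (ζ x)
        + (1 - Module.finrank ℝ E) * α) * inner ℝ v w
      + (mvfderiv I μ x v - mvfderiv I f x v) * inner ℝ w (ζ x) := by
  obtain ⟨U, X, hU, hx, hX, h⟩ := exists_common_extension ![v, w, w, w]
  have hY := hX 0
  have hW := hX 1
  obtain ⟨rfl, rfl⟩ : X 0 x = v ∧ X 1 x = w := ⟨h 0, h 1⟩
  set Y := X 0
  set W := X 1
  have hZ : SmoothField U ζ := hζ.smoothOn
  have hf' : SmoothFun I U f := hf.contMDiffOn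
  have hμ' : SmoothFun I U μ := hμ.contMDiffOn
  have hF : SmoothField U (grad I f) := smooth_grad hU hf'
  have H : ∀ A B : Π x : M, TangentSpace I x, ∀ y, ip (nabla A (grad I f)) B y
      = μ y * ip A B y - α * ricci I y (A y) (B y) := fun A B y ↦ hs y (A y) (B y)
  have Hζ : ∀ B : Π x : M, TangentSpace I x, ∀ y, ip (nabla ζ (grad I f)) B y
      = (μ y - (1 - Module.finrank ℝ E) * α) * ip ζ B y := fun B y ↦ by
    rw [H, ricci_comm, hζ.ricci_zeta]
    simp only [ip]
    rw [real_inner_comm (ζ y) (B y)]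
    ring
  -- the value of `g(R(ζ,Y)∇f, W)` given by the Kenmotsu curvature identity
  have R1 := hζ.riem_zeta_first (v := Y x) (w := grad I f x) (z := W x)
  rw [riem_eq hU hZ hY hF hx] at R1
  -- the value given by the soliton equation
  have D1 := der_ip hU hZ (hY.smooth_nabla hU hF) hW hx
  have D2 := der_ip hU hY (hZ.smooth_nabla hU hF) hW hx
  have hS : SmoothFun I U fun y ↦ ricci I y (Y y) (W y) := smooth_ricci hU hY hW
  have hYW : SmoothFun I U (ip Y W) := hY.smooth_ip hW
  have hζW : SmoothFun I U (ip ζ W) := hZ.smooth_ip hW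
  rw [der_congr hU (g := fun y ↦ μ y * ip Y W y - α * ricci I y (Y y) (W y))
    (fun y _ ↦ H Y W y) hx, der_sub hU (f := fun y ↦ μ y * ip Y W y)
    (ContMDiffOn.mul hμ' hYW) (SmoothFun.const_mul α hS) hx, der_mul hU hμ' hYW hx,
    der_const_mul hU α hS hx, hζ.der_zeta_ricci hU hY hW hx, H, der_ip hU hZ hY hW hx] at D1
  rw [der_congr hU (fun y _ ↦ Hζ W y) hx,
    der_mul hU (SmoothFun.sub hμ' contMDiffOn_const) hζW hx,
    der_sub hU hμ' contMDiffOn_const hx, der_const, Hζ, der_ip hU hY hZ hW hx] at D2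
  have D3 := H (br ζ Y) W x
  have e : ip (curv ζ Y (grad I f)) W x = ip (nabla ζ (nabla Y (grad I f))) W x
      - ip (nabla Y (nabla ζ (grad I f))) W x - ip (nabla (br ζ Y) (grad I f)) W x := by
    simp only [ip, curv_apply, inner_sub_left]
  rw [e, D3] at R1
  simp only [ip, ← nabla_torsion hU hZ hY hx, hζ.nabla_zeta, inner_sub_left, real_inner_smul_left,
    ricci_sub_left, ricci_smul_left, inner_grad] at R1 D1 D2
  rw [ricci_comm (v := ζ x), hζ.ricci_zeta, real_inner_comm (W x) (ζ x)] at R1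
  rw [real_inner_comm (W x) (ζ x)] at D2
  rw [real_inner_comm (grad I f x) (Y x), inner_grad] at R1
  simp only [der] at D1 D2
  linear_combination R1 + D1 - D2

/-- `μ - f` varies along `ζ` only. -/
theorem mvfderiv_sub_eq (hf : ContMDiff I 𝓘(ℝ) ∞ f) (hμ : ContMDiff I 𝓘(ℝ) ∞ μ)
    (hs : ∀ (x : M) (v w : TangentSpace I x),
      hessian I f x v w = μ x * inner ℝ v w - α * ricci I x v w) (v : TangentSpace I x) :
    mvfderiv I μ x v - mvfderiv I f x v
      = (mvfderiv I μ x (ζ x) - mvfderiv I f x (ζ x)) * inner ℝ v (ζ x) := by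
  have h := hζ.ricci_of_hessian hf hμ hs v (ζ x)
  rw [hζ.ricci_zeta, hζ.unit] at h
  linear_combination -h

/-- The trace of the soliton identity computes the derivative of `μ - f` along `ζ`. -/
theorem mvfderiv_zeta_sub (hm : (Module.finrank ℝ E : ℝ) - 1 ≠ 0)
    (hf : ContMDiff I 𝓘(ℝ) ∞ f) (hμ : ContMDiff I 𝓘(ℝ) ∞ μ)
    (hs : ∀ (x : M) (v w : TangentSpace I x),
      hessian I f x v w = μ x * inner ℝ v w - α * ricci I x v w) :
    mvfderiv I μ x (ζ x) - mvfderiv I f x (ζ x) = - (α *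
      (scalarCurvature I x / (Module.finrank ℝ E - 1) + Module.finrank ℝ E)) := by
  set κ := mvfderiv I μ x (ζ x) - mvfderiv I f x (ζ x) with hκ
  set b := stdOrthonormalBasis ℝ (TangentSpace I x) with hb
  have h : ∀ i, α * ricci I x (b i) (b i) = (-κ + (1 - Module.finrank ℝ E) * α)
      * inner ℝ (b i) (b i) + κ * (inner ℝ (ζ x) (b i) * inner ℝ (b i) (ζ x)) := fun i ↦ by
    rw [hζ.ricci_of_hessian hf hμ hs, hζ.mvfderiv_sub_eq hf hμ hs, real_inner_comm (ζ x) (b i)]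
    ring
  have h1 : ∑ i, inner ℝ (b i) (b i) = (Module.finrank ℝ E : ℝ) := by
    simp [b]
    rfl
  have h2 := Finset.sum_congr (rfl : Finset.univ = Finset.univ) fun i _ ↦ h i
  rw [← Finset.mul_sum, ← scalarCurvature_eq_sum b, Finset.sum_add_distrib, ← Finset.mul_sum,
    ← Finset.mul_sum, h1, b.sum_inner_mul_inner, hζ.unit] at h2
  field_simp
  linear_combination h2

/-- The Ricci tensor of a Kenmotsu gradient almost Ricci-Yamabe soliton. -/
theorem ricci_eq (hα : α ≠ 0) (hm : (Module.finrank ℝ E : ℝ) - 1 ≠ 0)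
    (hf : ContMDiff I 𝓘(ℝ) ∞ f) (hμ : ContMDiff I 𝓘(ℝ) ∞ μ)
    (hs : ∀ (x : M) (v w : TangentSpace I x),
      hessian I f x v w = μ x * inner ℝ v w - α * ricci I x v w) (v w : TangentSpace I x) :
    ricci I x v w = (scalarCurvature I x / (Module.finrank ℝ E - 1) + 1) * inner ℝ v w
      - (scalarCurvature I x / (Module.finrank ℝ E - 1) + Module.finrank ℝ E)
        * (inner ℝ v (ζ x) * inner ℝ w (ζ x)) := by
  have h1 := hζ.mvfderiv_zeta_sub (x := x) hm hf hμ hs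
  have h2 := hζ.mvfderiv_sub_eq hf hμ hs v
  rw [h1] at h2
  have h := hζ.ricci_of_hessian hf hμ hs v w
  rw [h2] at h
  refine mul_left_cancel₀ hα ?_
  linear_combination h - inner ℝ v w * h1

/-- The second derivative along `ζ` of a function with `∇²f = u g`. -/
theorem der_zeta_der_zeta {u : M → ℝ} (hf : ContMDiff I 𝓘(ℝ) ∞ f)
    (hs : ∀ (x : M) (v w : TangentSpace I x), hessian I f x v w = u x * inner ℝ v w) :
    der ζ (der ζ f) x = u x := by
  have hF : SmoothField univ (grad I f) := smooth_grad isOpen_univ hf.contMDiffOn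
  have h1 : der ζ f = ip (grad I f) ζ := funext fun y ↦ (inner_grad _).symm
  rw [h1, der_ip isOpen_univ hζ.smooth hF hζ.smooth (mem_univ x)]
  have h2 : ip (grad I f) (nabla ζ ζ) x = 0 := by
    simp only [ip, hζ.nabla_zeta_zeta, inner_zero_right]
  have h3 : ip (nabla ζ (grad I f)) ζ x = u x * inner ℝ (ζ x) (ζ x) := hs x (ζ x) (ζ x)
  rw [h2, h3, hζ.unit]
  ring

/-! ### Solutions of `ζ ζ u = u` along integral curves -/

/-- A function `u` with `ζ ζ u = u` is a combination of `cosh` and `sinh` along the integral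
curves of `ζ`. -/
theorem exists_cosh_sinh_integralCurve {u : M → ℝ} (hu : ContMDiff I 𝓘(ℝ) ∞ u)
    (huu : ∀ x, der ζ (der ζ u) x = u x) {γ : ℝ → M} {a b : ℝ}
    (hγ : IsMIntegralCurveOn (I := I) γ ζ (Ioo a b)) :
    ∃ A B : ℝ, ∀ t ∈ Ioo a b, u (γ t) = A * Real.cosh t + B * Real.sinh t := by
  have hd : ∀ h : M → ℝ, SmoothFun I univ h → ∀ t ∈ Ioo a b,
      HasDerivAt (fun s ↦ h (γ s)) (der ζ h (γ t)) t := by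
    intro h hh t ht
    have h1 := (hγ t ht).hasMFDerivAt (isOpen_Ioo.mem_nhds ht)
    have h2 := (hh.mdifferentiableAt isOpen_univ (mem_univ (γ t))).hasMFDerivAt
    have h3 : HasFDerivAt (fun s ↦ h (γ s))
        ((mvfderiv I h (γ t)).comp ((1 : ℝ →L[ℝ] ℝ).smulRight (ζ (γ t)))) t :=
      (h2.comp t h1).hasFDerivAt
    refine h3.hasDerivAt.congr_deriv ?_
    simp [der]
  have hw : SmoothFun I univ (der ζ u) := hζ.smooth.smooth_der isOpen_univ hu.contMDiffOn
  have h1 := hd u hu.contMDiffOn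
  have h2 := hd _ hw
  have hc : ∀ t, HasDerivAt Real.cosh (Real.sinh t) t := Real.hasDerivAt_cosh
  have hs : ∀ t, HasDerivAt Real.sinh (Real.cosh t) t := Real.hasDerivAt_sinh
  have const : ∀ F : ℝ → ℝ, (∀ t ∈ Ioo a b, HasDerivAt F 0 t) → ∃ c, ∀ t ∈ Ioo a b, F t = c := by
    intro F hF
    rcases (Ioo a b).eq_empty_or_nonempty with h | ⟨s, hs⟩
    · exact ⟨0, by simp [h]⟩
    · refine ⟨F s, fun t ht ↦ ?_⟩
      exact isOpen_Ioo.is_const_of_deriv_eq_zero isPreconnected_Ioo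
        (fun t ht ↦ (hF t ht).differentiableAt.differentiableWithinAt)
        (fun t ht ↦ (hF t ht).deriv) ht hs
  obtain ⟨A, hA⟩ := const (fun t ↦ u (γ t) * Real.cosh t - der ζ u (γ t) * Real.sinh t)
    fun t ht ↦ by
      refine (((h1 t ht).mul (hc t)).sub ((h2 t ht).mul (hs t))).congr_deriv ?_
      rw [huu]
      ring
  obtain ⟨B, hB⟩ := const (fun t ↦ der ζ u (γ t) * Real.cosh t - u (γ t) * Real.sinh t)
    fun t ht ↦ by
      refine (((h2 t ht).mul (hc t)).sub ((h1 t ht).mul (hs t))).congr_deriv ?_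
      rw [huu]
      ring
  refine ⟨A, B, fun t ht ↦ ?_⟩
  rw [← hA t ht, ← hB t ht]
  linear_combination -u (γ t) * Real.cosh_sq t

end IsKenmotsuField

end

/-! ### Coordinate vector fields -/

/-- The coordinate vector field of the chart at `p` in the direction `v`. -/
def coordField (p : M) (v : E) : Π x : M, TangentSpace I x :=
  fun y ↦ (trivializationAt E (TangentSpace I) p).symmL ℝ y v

section coordField

variable {p : M} {v w : E}

theorem smooth_coordField :
    SmoothField (I := I) (chartAt H p).source (coordField p v) := by
  have h : SmoothField (I := I) (trivializationAt E (TangentSpace I) p).baseSet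
      (coordField p v) := by
    rw [SmoothField, (trivializationAt E (TangentSpace I) p).contMDiffOn_section_baseSet_iff]
    refine (contMDiffOn_const (c := v)).congr fun y hy ↦ ?_
    have h := congr_arg Prod.snd ((trivializationAt E (TangentSpace I) p).apply_mk_symm hy v)
    rw [← Bundle.Trivialization.symmL_apply (R := ℝ) _ hy] at h
    exact h
  rwa [TangentBundle.trivializationAt_baseSet] at h

theorem mfderiv_extChartAt_coordField (hx : x ∈ (chartAt H p).source) :
    mfderiv I 𝓘(ℝ, E) (extChartAt I p) x (coordField p v x) = v := by
  rw [← TangentBundle.continuousLinearMapAt_trivializationAt hx]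
  exact Bundle.Trivialization.continuousLinearMapAt_symmL _
    (by rwa [TangentBundle.trivializationAt_baseSet]) v

theorem coordField_mfderiv_extChartAt (hx : x ∈ (chartAt H p).source) (u : TangentSpace I x) :
    coordField p (show E from mfderiv I 𝓘(ℝ, E) (extChartAt I p) x u) x = u := by
  rw [← TangentBundle.continuousLinearMapAt_trivializationAt hx]
  exact Bundle.Trivialization.symmL_continuousLinearMapAt _
    (by rwa [TangentBundle.trivializationAt_baseSet]) u

/-- The constant vector field on the model space `E`. -/
def constField (c : E) : Π z : E, TangentSpace 𝓘(ℝ, E) z := fun _ ↦ c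

theorem mdifferentiableAt_constField (c z : E) : MDiffAt (T% (constField c)) z := by
  exact (contMDiffAt_vectorSpace_iff_contDiffAt.2
    (contDiffAt_const (c := c) (n := 1))).mdifferentiableAt one_ne_zero

theorem mlieBracket_constField (c d z : E) :
    VectorField.mlieBracket 𝓘(ℝ, E) (constField c) (constField d) z = 0 := by
  rw [← VectorField.mlieBracketWithin_univ, VectorField.mlieBracketWithin_eq_lieBracketWithin]
  have h : ∀ c : E, fderivWithin ℝ (fun _ : E ↦ c) univ z = 0 := fun c ↦
    fderivWithin_const_apply c
  change fderivWithin ℝ (fun _ : E ↦ d) univ z c - fderivWithin ℝ (fun _ : E ↦ c) univ z d = 0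
  rw [h, h]
  exact sub_self 0

/-- Coordinate vector fields of one chart commute. -/
theorem br_coordField (hx : x ∈ (chartAt H p).source) :
    br (coordField (I := I) p v) (coordField p w) x = 0 := by
  have : CompleteSpace E := FiniteDimensional.complete ℝ E
  have : IsManifold I (minSmoothness ℝ 2) M := by
    simp only [minSmoothness_of_isRCLikeNormedField]; infer_instance
  have hp : ∀ (c : E), ∀ y ∈ (chartAt H p).source, coordField (I := I) p c y
      = VectorField.mpullback I 𝓘(ℝ, E) (extChartAt I p) (constField c) y := by
    intro c y hy
    rw [VectorField.mpullback_apply]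
    have hinv := isInvertible_mfderiv_extChartAt (I := I) (x := p) (y := y)
      (by rwa [extChartAt_source])
    exact (hinv.inverse_apply_eq.2 (mfderiv_extChartAt_coordField hy).symm).symm
  rw [br_congr (chartAt H p).open_source (hp v) (hp w) hx, br,
    ← VectorField.mpullback_mlieBracket (n := 2) (mdifferentiableAt_constField _ _)
      (mdifferentiableAt_constField _ _) (contMDiffAt_extChartAt' hx)
      minSmoothness_of_isRCLikeNormedField.le,
    VectorField.mpullback_apply, mlieBracket_constField, map_zero]

variable [I.Boundaryless]

/-- The derivative of `f` read in the chart is the derivative along coordinate fields. -/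
theorem fderiv_comp_extChartAt_symm (hf : SmoothFun I (chartAt H p).source f) {z : E}
    (hz : z ∈ (extChartAt I p).target) :
    fderiv ℝ (fun z ↦ f ((extChartAt I p).symm z)) z v
      = der (coordField (I := I) p v) f ((extChartAt I p).symm z) := by
  set q := (extChartAt I p).symm z with hq
  have hqs : q ∈ (chartAt H p).source := by
    rw [← extChartAt_source I]; exact (extChartAt I p).map_target hz
  have hz' : extChartAt I p q = z := (extChartAt I p).right_inv hz
  have hg : ContDiffAt ℝ ∞ (fun z ↦ f ((extChartAt I p).symm z)) z := by
    have h1 : ContMDiffAt 𝓘(ℝ, E) I ∞ (extChartAt I p).symm z :=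
      (contMDiffOn_extChartAt_symm (I := I) (n := ∞) p).contMDiffAt
        ((isOpen_extChartAt_target (I := I) p).mem_nhds hz)
    have h2 : ContMDiffAt I 𝓘(ℝ) ∞ f ((extChartAt I p).symm z) :=
      ContMDiffOn.contMDiffAt hf ((chartAt H p).open_source.mem_nhds hqs)
    exact (ContMDiffAt.comp z h2 h1).contDiffAt
  have hg' : HasMFDerivAt 𝓘(ℝ, E) 𝓘(ℝ) (fun z ↦ f ((extChartAt I p).symm z)) (extChartAt I p q)
      (fderiv ℝ (fun z ↦ f ((extChartAt I p).symm z)) z) := by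
    rw [hz']
    exact (hg.differentiableAt (by simp)).hasFDerivAt.hasMFDerivAt
  have hφ := (mdifferentiableAt_extChartAt (I := I) hqs).hasMFDerivAt
  have hc := (hg'.comp q hφ).mfderiv
  have e : der (coordField (I := I) p v) f q
      = der (coordField p v) ((fun z ↦ f ((extChartAt I p).symm z)) ∘ extChartAt I p) q :=
    der_congr (chartAt H p).open_source (fun y hy ↦ by
      rw [Function.comp_apply, (extChartAt I p).left_inv (by rwa [extChartAt_source])]) hqs
  rw [e]
  simp only [der, mvfderiv, hc]
  have h3 := mfderiv_extChartAt_coordField (I := I) (v := v) hqs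
  exact congr(fderiv ℝ (fun z ↦ f ((extChartAt I p).symm z)) z $h3).symm

end coordField

/-! ### Local potentials of `η` and local solutions of `ζ ζ u = u` -/

theorem der_comp (hU : IsOpen U) (hf : SmoothFun I U f) {g : ℝ → ℝ} {g' : ℝ}
    (hg : HasDerivAt g g' (f x)) (hx : x ∈ U) :
    der X (fun y ↦ g (f y)) x = g' * der X f x := by
  have h1 := (hf.mdifferentiableAt hU hx).hasMFDerivAt
  have h2 := (hg.hasFDerivAt.hasMFDerivAt.comp x h1).mfderiv
  have h3 : (fun y ↦ g (f y)) = g ∘ f := rfl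
  rw [h3]
  simp only [der, mvfderiv, h2]
  exact mul_comm (G := ℝ) _ _

namespace IsKenmotsuField

variable [Nontrivial E] [I.Boundaryless] {ζ : Π x : M, TangentSpace I x} (hζ : IsKenmotsuField ζ)

include hζ

/-- The `1`-form `η = g(·, ζ)` is closed, hence locally exact by the Poincaré lemma in a chart. -/
theorem exists_potential (p : M) : ∃ (U : Set M) (t : M → ℝ), IsOpen U ∧ p ∈ U ∧
    SmoothFun I U t ∧ ∀ x ∈ U, ∀ v, mvfderiv I t x v = inner ℝ v (ζ x) := by
  have hS := (chartAt H p).open_source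
  have hC : ∀ v : E, SmoothField (I := I) (chartAt H p).source (coordField p v) :=
    fun v ↦ smooth_coordField
  have hh : ∀ v : E, SmoothFun I (chartAt H p).source (ip (coordField p v) ζ) :=
    fun v ↦ (hC v).smooth_ip hζ.smoothOn
  -- the form `η` read in the chart at `p`
  let θ : E → E →L[ℝ] ℝ := fun z ↦ (innerSL ℝ (ζ ((extChartAt I p).symm z))).comp
    ((trivializationAt E (TangentSpace I) p).symmL ℝ ((extChartAt I p).symm z))
  have hθ : ∀ z v, θ z v = ip (coordField p v) ζ ((extChartAt I p).symm z) := fun z v ↦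
    real_inner_comm (coordField p v ((extChartAt I p).symm z)) (ζ ((extChartAt I p).symm z))
  have hθs : ContDiffOn ℝ ∞ θ (extChartAt I p).target := by
    rw [contDiffOn_clm_apply]
    intro v
    simp only [hθ]
    rw [← contMDiffOn_iff_contDiffOn]
    refine ContMDiffOn.comp (hh v) (contMDiffOn_extChartAt_symm (I := I) (n := ∞) p) fun z hz ↦ ?_
    rw [mem_preimage, ← extChartAt_source I]
    exact (extChartAt I p).map_target hz
  obtain ⟨ε, hε, hball⟩ := Metric.isOpen_iff.1 (isOpen_extChartAt_target (I := I) p) _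
    (mem_extChartAt_target p)
  set B := Metric.ball (extChartAt I p p) ε
  have hθd : ∀ z ∈ B, DifferentiableAt ℝ θ z := fun z hz ↦
    (hθs.contDiffAt ((isOpen_extChartAt_target (I := I) p).mem_nhds (hball hz))).differentiableAt
      (by simp)
  -- `v (η(w)) - w (η(v)) = 0` for commuting `v`, `w`, as `∇η` is symmetric
  have hsymm : ∀ z ∈ B, ∀ v w, fderiv ℝ θ z v w = fderiv ℝ θ z w v := by
    intro z hz
    have hq : (extChartAt I p).symm z ∈ (chartAt H p).source := by
      rw [← extChartAt_source I]
      exact (extChartAt I p).map_target (hball hz)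
    have key : ∀ v w, fderiv ℝ θ z v w
        = der (coordField (I := I) p v) (ip (coordField p w) ζ) ((extChartAt I p).symm z) := by
      intro v w
      rw [← fderiv_comp_extChartAt_symm (hh w) (hball hz)]
      simp only [← hθ]
      rw [fderiv_clm_apply (hθd z hz) (differentiableAt_const w)]
      simp
    intro v w
    have hb := br_coordField (I := I) (v := v) (w := w) hq
    rw [← nabla_torsion hS (hC v) (hC w) hq, sub_eq_zero] at hb
    rw [key, key, hζ.der_ip_zeta hS (hC v) (hC w) hq, hζ.der_ip_zeta hS (hC w) (hC v) hq, hb,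
      real_inner_comm (coordField p w _)]
    ring
  obtain ⟨T, hT⟩ := (convex_ball (extChartAt I p p) ε).exists_forall_hasFDerivAt_of_fderiv_symmetric
    Metric.isOpen_ball (fun z hz ↦ (hθd z hz).differentiableWithinAt) hsymm
  have hTs : ContDiffOn ℝ ∞ T B := by
    rw [contDiffOn_infty_iff_fderiv_of_isOpen Metric.isOpen_ball]
    exact ⟨fun z hz ↦ (hT z hz).differentiableAt.differentiableWithinAt,
      (hθs.mono hball).congr fun z hz ↦ (hT z hz).fderiv⟩
  refine ⟨(chartAt H p).source ∩ extChartAt I p ⁻¹' B, fun x ↦ T (extChartAt I p x), ?_,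
    ⟨mem_chart_source H p, Metric.mem_ball_self hε⟩, ?_, ?_⟩
  · exact isOpen_extChartAt_preimage (I := I) p Metric.isOpen_ball
  · exact ContMDiffOn.comp (contMDiffOn_iff_contDiffOn.2 hTs)
      (contMDiffOn_extChartAt.mono inter_subset_left) fun x hx ↦ hx.2
  · intro x hx v
    have h1 := (hT _ hx.2).hasMFDerivAt
    have h2 := (mdifferentiableAt_extChartAt (I := I) hx.1).hasMFDerivAt
    have h3 := (h1.comp x h2).mfderiv
    have h4 : (fun x ↦ T (extChartAt I p x)) = T ∘ extChartAt I p := rfl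
    rw [h4]
    simp only [mvfderiv, h3]
    have h5 := hθ (extChartAt I p x) (mfderiv I 𝓘(ℝ, E) (extChartAt I p) x v)
    rw [(extChartAt I p).left_inv (by rw [extChartAt_source]; exact hx.1)] at h5
    have h6 := coordField_mfderiv_extChartAt hx.1 v
    exact h5.trans congr(inner ℝ $h6 (ζ x))

/-- Locally, a function `u` with `ζ ζ u = u` is a combination of `cosh t` and `sinh t` with
coefficients constant along `ζ`, for a potential `t` of `η`. -/
theorem exists_cosh_sinh_local {u : M → ℝ} (hu : ContMDiff I 𝓘(ℝ) ∞ u)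
    (huu : ∀ x, der ζ (der ζ u) x = u x) (p : M) :
    ∃ (U : Set M) (t A B : M → ℝ), IsOpen U ∧ p ∈ U ∧ SmoothFun I U t ∧ SmoothFun I U A ∧
      SmoothFun I U B ∧ (∀ x ∈ U, ∀ v, mvfderiv I t x v = inner ℝ v (ζ x)) ∧
      (∀ x ∈ U, der ζ A x = 0) ∧ (∀ x ∈ U, der ζ B x = 0) ∧
      ∀ x ∈ U, u x = A x * Real.cosh (t x) + B x * Real.sinh (t x) := by
  obtain ⟨U, t, hU, hp, ht, hdt⟩ := hζ.exists_potential p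
  have hu' : SmoothFun I U u := hu.contMDiffOn
  have hw : SmoothFun I U (der ζ u) := hζ.smoothOn.smooth_der hU hu'
  have hc : SmoothFun I U fun x ↦ Real.cosh (t x) :=
    Real.contDiff_cosh.contMDiff.comp_contMDiffOn ht
  have hs : SmoothFun I U fun x ↦ Real.sinh (t x) :=
    Real.contDiff_sinh.contMDiff.comp_contMDiffOn ht
  have ht1 : ∀ x ∈ U, der ζ t x = 1 := fun x hx ↦ (hdt x hx _).trans (hζ.unit x)
  have hdc : ∀ x ∈ U, der ζ (fun x ↦ Real.cosh (t x)) x = Real.sinh (t x) := fun x hx ↦ by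
    rw [der_comp hU ht (Real.hasDerivAt_cosh _) hx, ht1 x hx, mul_one]
  have hds : ∀ x ∈ U, der ζ (fun x ↦ Real.sinh (t x)) x = Real.cosh (t x) := fun x hx ↦ by
    rw [der_comp hU ht (Real.hasDerivAt_sinh _) hx, ht1 x hx, mul_one]
  refine ⟨U, t, fun x ↦ u x * Real.cosh (t x) - der ζ u x * Real.sinh (t x),
    fun x ↦ der ζ u x * Real.cosh (t x) - u x * Real.sinh (t x), hU, hp, ht,
    SmoothFun.sub (ContMDiffOn.mul hu' hc) (ContMDiffOn.mul hw hs),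
    SmoothFun.sub (ContMDiffOn.mul hw hc) (ContMDiffOn.mul hu' hs), hdt, fun x hx ↦ ?_,
    fun x hx ↦ ?_, fun x hx ↦ ?_⟩
  · rw [der_sub hU (f := fun x ↦ u x * Real.cosh (t x)) (g := fun x ↦ der ζ u x * Real.sinh (t x))
      (ContMDiffOn.mul hu' hc) (ContMDiffOn.mul hw hs) hx, der_mul hU hu' hc hx,
      der_mul hU hw hs hx, hdc x hx, hds x hx, huu]
    ring
  · rw [der_sub hU (f := fun x ↦ der ζ u x * Real.cosh (t x)) (g := fun x ↦ u x * Real.sinh (t x))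
      (ContMDiffOn.mul hw hc) (ContMDiffOn.mul hu' hs) hx, der_mul hU hw hc hx,
      der_mul hU hu' hs hx, hdc x hx, hds x hx, huu]
    ring
  · linear_combination -u x * Real.cosh_sq (t x)

end IsKenmotsuField

/-! ### The Ricci operator and the soliton function -/

theorem ricciOp_eq {ζ : Π x : M, TangentSpace I x} {a b : ℝ}
    (h : ∀ v w : TangentSpace I x,
      ricci I x v w = a * inner ℝ v w - b * (inner ℝ v (ζ x) * inner ℝ w (ζ x)))
    (v : TangentSpace I x) : ricciOp I x v = a • v - (b * inner ℝ v (ζ x)) • ζ x := by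
  set e := stdOrthonormalBasis ℝ (TangentSpace I x)
  have h1 := e.sum_repr' v
  have h2 := e.sum_repr' (ζ x)
  have h3 : ricciOp I x v = ∑ i, ricci I x v (e i) • e i := rfl
  have h4 : a • v - (b * inner ℝ v (ζ x)) • ζ x = a • ∑ i, inner ℝ (e i) v • e i
      - (b * inner ℝ v (ζ x)) • ∑ i, inner ℝ (e i) (ζ x) • e i := by rw [h1, h2]
  rw [h3, h4, Finset.smul_sum, Finset.smul_sum, ← Finset.sum_sub_distrib]
  refine Finset.sum_congr rfl fun i _ ↦ ?_
  rw [h, smul_smul, smul_smul, ← sub_smul, real_inner_comm (e i) v]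
  congr 1
  ring

namespace IsKenmotsuField

variable [Nontrivial E] {ζ : Π x : M, TangentSpace I x} (hζ : IsKenmotsuField ζ) {α : ℝ}
  {μ : M → ℝ}

include hζ

/-- In dimension `2n + 1` with `r = -2n(2n+1)`, the metric is Einstein and `u = μ + 2nα` satisfies
`∇²f = u g` and `ζ u = ζ f`, whence `ζ ζ u = u`. -/
theorem der_zeta_der_zeta_of_soliton (hα : α ≠ 0) (hm : (Module.finrank ℝ E : ℝ) - 1 ≠ 0)
    (hf : ContMDiff I 𝓘(ℝ) ∞ f) (hμ : ContMDiff I 𝓘(ℝ) ∞ μ)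
    (hs : ∀ (x : M) (v w : TangentSpace I x),
      hessian I f x v w = μ x * inner ℝ v w - α * ricci I x v w)
    (hr : ∀ x : M, scalarCurvature I x = (1 - Module.finrank ℝ E) * Module.finrank ℝ E) (x : M) :
    der ζ (der ζ fun y ↦ μ y + (Module.finrank ℝ E - 1) * α) x
      = μ x + (Module.finrank ℝ E - 1) * α := by
  have hq : ∀ x : M, scalarCurvature I x / (Module.finrank ℝ E - 1) = - Module.finrank ℝ E :=
    fun x ↦ by
      rw [hr, div_eq_iff hm]
      ring
  have hd : (der ζ fun y ↦ μ y + (Module.finrank ℝ E - 1) * α) = der ζ f := by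
    funext y
    rw [der_add isOpen_univ hμ.contMDiffOn contMDiffOn_const (mem_univ y), der_const]
    have h := hζ.mvfderiv_zeta_sub (x := y) hm hf hμ hs
    rw [hq] at h
    simp only [der]
    linear_combination h
  rw [hd]
  refine hζ.der_zeta_der_zeta (u := fun y ↦ μ y + (Module.finrank ℝ E - 1) * α) hf
    fun x v w ↦ ?_
  rw [hs, hζ.ricci_eq hα hm hf hμ hs, hq]
  ring

end IsKenmotsuField

end Calculus

end Kenmotsu

end

theorem mainTheorem1 (n : ℕ) (hn : 1 ≤ n) {M : Type*} [TopologicalSpace M] [T2Space M]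
    [ChartedSpace (EuclideanSpace ℝ (Fin (2 * n + 1))) M] [IsManifold (𝓡 (2 * n + 1)) ∞ M]
    [RiemannianBundle (fun x : M ↦ TangentSpace (𝓡 (2 * n + 1)) x)]
    [IsContMDiffRiemannianBundle (𝓡 (2 * n + 1)) ∞ (EuclideanSpace ℝ (Fin (2 * n + 1)))
      (fun x : M ↦ TangentSpace (𝓡 (2 * n + 1)) x)]
    (φ : Π x : M, TangentSpace (𝓡 (2 * n + 1)) x →L[ℝ] TangentSpace (𝓡 (2 * n + 1)) x)
    (ζ : Π x : M, TangentSpace (𝓡 (2 * n + 1)) x)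
    (η : Π x : M, TangentSpace (𝓡 (2 * n + 1)) x →L[ℝ] ℝ)
    (hK : Kenmotsu.IsKenmotsu (𝓡 (2 * n + 1)) φ ζ η)
    (α β : ℝ) (hα : α ≠ 0) (f lam : M → ℝ)
    (hs : Kenmotsu.IsGradientAlmostRicciYamabeSoliton (𝓡 (2 * n + 1)) α β f lam) :
    Kenmotsu.IsEtaEinstein (𝓡 (2 * n + 1)) η ∧
    (∀ (x : M) (v : TangentSpace (𝓡 (2 * n + 1)) x),
      Kenmotsu.ricciOp (𝓡 (2 * n + 1)) x v
        = (Kenmotsu.scalarCurvature (𝓡 (2 * n + 1)) x / (2 * n) + 1) • v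
          - ((Kenmotsu.scalarCurvature (𝓡 (2 * n + 1)) x / (2 * n) + 2 * n + 1) * η x v) • ζ x) ∧
    ((∀ x : M, mvfderiv (𝓡 (2 * n + 1))
        (fun y : M ↦ Kenmotsu.scalarCurvature (𝓡 (2 * n + 1)) y) x (ζ x) = 0) →
      (∀ p : M, ∃ (U : Set M) (t A B : M → ℝ), IsOpen U ∧ p ∈ U ∧
        ContMDiffOn (𝓡 (2 * n + 1)) 𝓘(ℝ) ∞ t U ∧
        ContMDiffOn (𝓡 (2 * n + 1)) 𝓘(ℝ) ∞ A U ∧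
        ContMDiffOn (𝓡 (2 * n + 1)) 𝓘(ℝ) ∞ B U ∧
        (∀ x ∈ U, mvfderiv (𝓡 (2 * n + 1)) t x = η x) ∧
        (∀ x ∈ U, mvfderiv (𝓡 (2 * n + 1)) A x (ζ x) = 0) ∧
        (∀ x ∈ U, mvfderiv (𝓡 (2 * n + 1)) B x (ζ x) = 0) ∧
        (∀ x ∈ U, lam x = A x * Real.cosh (t x) + B x * Real.sinh (t x)
          - 2 * n * α - n * β * (2 * n + 1))) ∧
      (∀ (γ : ℝ → M) (a b : ℝ), IsMIntegralCurveOn (I := 𝓡 (2 * n + 1)) γ ζ (Ioo a b) →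
        ∃ A B : ℝ, ∀ t ∈ Ioo a b, lam (γ t) = A * Real.cosh t + B * Real.sinh t
          - 2 * n * α - n * β * (2 * n + 1))) := by

  have hm : Module.finrank ℝ (EuclideanSpace ℝ (Fin (2 * n + 1))) = 2 * n + 1 := by simp
  have hm' : (Module.finrank ℝ (EuclideanSpace ℝ (Fin (2 * n + 1))) : ℝ) = 2 * n + 1 := by
    rw [hm]; push_cast; ring
  have hn' : (n : ℝ) ≠ 0 := Nat.cast_ne_zero.2 (by omega)
  have hm1 : (Module.finrank ℝ (EuclideanSpace ℝ (Fin (2 * n + 1))) : ℝ) - 1 ≠ 0 := by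
    rw [hm']; simpa using hn'
  have hζ := hK.isKenmotsuField
  have hf := hs.smooth_potential
  have hr : ContMDiff (𝓡 (2 * n + 1)) 𝓘(ℝ) ∞
      (Kenmotsu.scalarCurvature (𝓡 (2 * n + 1)) : M → ℝ) := Kenmotsu.smooth_scalarCurvature
  have hμ : ContMDiff (𝓡 (2 * n + 1)) 𝓘(ℝ) ∞
      fun x ↦ lam x - 1 / 2 * β * Kenmotsu.scalarCurvature (𝓡 (2 * n + 1)) x :=
    hs.smooth_lam.sub (contMDiff_const.mul hr)
  have hs' : ∀ (x : M) (v w : TangentSpace (𝓡 (2 * n + 1)) x),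
      Kenmotsu.hessian (𝓡 (2 * n + 1)) f x v w
        = (lam x - 1 / 2 * β * Kenmotsu.scalarCurvature (𝓡 (2 * n + 1)) x) * inner ℝ v w
          - α * Kenmotsu.ricci (𝓡 (2 * n + 1)) x v w :=
    fun x v w ↦ eq_sub_of_add_eq (hs.soliton_eq x v w)
  have hS : ∀ (x : M) (v w : TangentSpace (𝓡 (2 * n + 1)) x),
      Kenmotsu.ricci (𝓡 (2 * n + 1)) x v w
        = (Kenmotsu.scalarCurvature (𝓡 (2 * n + 1)) x / (2 * n) + 1) * inner ℝ v w
          - (Kenmotsu.scalarCurvature (𝓡 (2 * n + 1)) x / (2 * n) + 2 * n + 1)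
            * (inner ℝ v (ζ x) * inner ℝ w (ζ x)) := fun x v w ↦ by
    rw [hζ.ricci_eq hα hm1 hf hμ hs', hm', add_sub_cancel_right, add_assoc _ (2 * (n : ℝ))]
  refine ⟨⟨fun x ↦ Kenmotsu.scalarCurvature (𝓡 (2 * n + 1)) x / (2 * n) + 1,
    fun x ↦ -(Kenmotsu.scalarCurvature (𝓡 (2 * n + 1)) x / (2 * n) + 2 * n + 1),
    ?_, ?_, fun x v w ↦ ?_⟩, fun x v ↦ ?_, fun hζr ↦ ?_⟩
  · exact (hr.div_const _).add contMDiff_const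
  · exact (((hr.div_const _).add contMDiff_const).add contMDiff_const).neg
  · rw [hS, hK.eta_apply, hK.eta_apply]
    ring
  · rw [hK.eta_apply]
    exact Kenmotsu.ricciOp_eq (hS x) v
  -- `0 = ζ r = -2 (r + 2n(2n+1))` determines `r`
  · have hr' : ∀ x : M, Kenmotsu.scalarCurvature (𝓡 (2 * n + 1)) x
        = (1 - Module.finrank ℝ (EuclideanSpace ℝ (Fin (2 * n + 1))))
          * Module.finrank ℝ (EuclideanSpace ℝ (Fin (2 * n + 1))) := fun x ↦ by
      have h := (hζ.der_zeta_scalarCurvature (x := x)).symm.trans (hζr x)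
      linear_combination -h / 2
    -- `u = μ + 2nα`, which equals `λ + 2nα + nβ(2n+1)` since `r = -2n(2n+1)`
    have huu := hζ.der_zeta_der_zeta_of_soliton hα hm1 hf hμ hs' hr'
    have hu := hμ.add (contMDiff_const (I := 𝓡 (2 * n + 1)) (I' := 𝓘(ℝ)) (M := M) (n := ∞)
      (c := ((Module.finrank ℝ (EuclideanSpace ℝ (Fin (2 * n + 1))) : ℝ) - 1) * α))
    have hlam : ∀ x, lam x
        = (lam x - 1 / 2 * β * Kenmotsu.scalarCurvature (𝓡 (2 * n + 1)) x
          + ((Module.finrank ℝ (EuclideanSpace ℝ (Fin (2 * n + 1))) : ℝ) - 1) * α)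
          - 2 * n * α - n * β * (2 * n + 1) := fun x ↦ by
      rw [hr', hm']
      ring
    refine ⟨fun p ↦ ?_, fun γ a b hγ ↦ ?_⟩
    · obtain ⟨U, t, A, B, hU, hp, ht, hA, hB, hdt, hA0, hB0, h⟩ :=
        hζ.exists_cosh_sinh_local hu huu p
      refine ⟨U, t, A, B, hU, hp, ht, hA, hB, fun x hx ↦ ?_, hA0, hB0, fun x hx ↦ ?_⟩
      · ext v
        rw [hdt x hx, hK.eta_apply]
      · rw [hlam, ← h x hx]
        rfl
    · obtain ⟨A, B, h⟩ := hζ.exists_cosh_sinh_integralCurve hu huu hγ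
      refine ⟨A, B, fun t ht ↦ ?_⟩
      rw [hlam, ← h t ht]
      rfl
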